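/- Let $M$ be a connected smooth manifold (without boundary) of dimension $n\ge 3$, let $TM$ be its tangent bundle with induced local coordinates $(x^i,y^i)$, and let $T_0M$ be $TM$ with the zero section removed. A Finsler metric on $M$ is a continuous function $F:TM\to\mathbb R$ that on $T_0M$ is positive, smooth and positively $1$-homogeneous in $y$, and for which the matrix $g_{ij}=\tfrac12\,\partial^2F^2/\partial y^i\partial y^j$ is positive definite at every point of $T_0M$. Its geodesic spray is the unique vector field on $T_0M$ of the form $$S=y^i\frac{\partial}{\partial x^i}-2G^i\frac{\partial}{\partial y^i}\quad\text{with}\quad S\Big(\frac{\partial F^2}{\partial y^i}\Big)-\frac{\partial F^2}{\partial x^i}=0 ,$$ and its geodesics are the regular curves with $\ddot x^i+2G^i(x,\dot x)=0$. The metric $F$ has constant flag curvature if there is a constant $\kappa\in\mathbb R$ such that on $T_0M$ $$R^i_j:=2\frac{\partial G^i}{\partial x^j}-S\Big(\frac{\partial G^i}{\partial y^j}\Big)-\frac{\partial G^i}{\partial y^k}\frac{\partial G^k}{\partial y^j}=\kappa\Big(F^2\delta^i_j-F\frac{\partial F}{\partial y^j}\,y^i\Big).$$ Let $F$ and $\widetilde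 F$ be two projectively related Finsler metrics on $M$, that is, their geodesics coincide as oriented non-parametrised curves, and let $S$, $\widetilde S$ be their geodesic sprays. Then there is a smooth function $P$ on $T_0M$, positively $1$-homogeneous in $y$ (the projective factor), with $\widetilde S=S-2P\,\mathcal C$, where $\mathcal C=y^i\,\partial/\partial y^i$. For this $P$, the following two conditions on $T_0M$ are equivalent: i) $\delta_SP=0$, where $\delta_SP=\big\{S\big(\tfrac{\partial P}{\partial y^i}\big)-\tfrac{\partial P}{\partial x^i}\big\}\,dx^i$; ii) $d_hd_JP=0$, that is, $\dfrac{\delta}{\delta x^i}\dfrac{\partial P}{\partial y^j}=\dfrac{\delta}{\delta x^j}\dfrac{\partial P}{\partial y^i}$ for all $i,j$, where $\dfrac{\delta}{\delta x^i}=\dfrac{\partial}{\partial x^i}-\dfrac{\partial G^k}{\partial y^i}\dfrac{\partial}{\partial y^k}$. If one of the metrics $F$, $\widetilde F$ (either one) has constant flag curvature, then the other has constant flag curvature if and only if $P$ satisfies these equivalent conditions, that is, if and only if $P$ is a Hamel function. -/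

import Mathlib

open scoped Manifold ContDiff

noncomputable section

namespace FinslerGeometry

/-- The model space `ℝⁿ`. -/
abbrev Vec (n : ℕ) := EuclideanSpace ℝ (Fin n)

/-! ### Calculus in induced coordinates `z = (x, y)` -/

section Coordinates

variable {n : ℕ}

/-- The partial derivative `∂f/∂xⁱ`. -/
def dX (i : Fin n) (f : Vec n × Vec n → ℝ) (z : Vec n × Vec n) : ℝ :=
  fderiv ℝ f z (EuclideanSpace.single i 1, 0)

/-- The partial derivative `∂f/∂yⁱ`. -/
def dY (i : Fin n) (f : Vec n × Vec n → ℝ) (z : Vec n × Vec n) : ℝ :=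
  fderiv ℝ f z (0, EuclideanSpace.single i 1)

/-- The derivative `S(f)` along the spray `S = yᵏ ∂/∂xᵏ - 2 Gᵏ ∂/∂yᵏ` with coefficients `Gᵏ`. -/
def sprayD (G : Fin n → Vec n × Vec n → ℝ) (f : Vec n × Vec n → ℝ) (z : Vec n × Vec n) : ℝ :=
  ∑ k, z.2 k * dX k f z - 2 * ∑ k, G k z * dY k f z

/-- The horizontal derivative `δf/δxⁱ = ∂f/∂xⁱ - (∂Gᵏ/∂yⁱ) ∂f/∂yᵏ`. -/
def horD (G : Fin n → Vec n × Vec n → ℝ) (i : Fin n) (f : Vec n × Vec n → ℝ)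
    (z : Vec n × Vec n) : ℝ :=
  dX i f z - ∑ k, dY i (G k) z * dY k f z

/-- The component along `dxⁱ` of the Euler-Lagrange form
`δ_S L = {S(∂L/∂yⁱ) - ∂L/∂xⁱ} dxⁱ`. -/
def eulerLagrangeForm (G : Fin n → Vec n × Vec n → ℝ) (L : Vec n × Vec n → ℝ) (i : Fin n)
    (z : Vec n × Vec n) : ℝ :=
  sprayD G (dY i L) z - dX i L z

/-- The component along `dxⁱ ∧ dxʲ` (for `i < j`) of the two-form `d_h d_J f`, where
`d_J f = (∂f/∂yʲ) dxʲ` and `d_h (αⱼ dxʲ) = (δαⱼ/δxⁱ) dxⁱ ∧ dxʲ`. -/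
def dhdJ (G : Fin n → Vec n × Vec n → ℝ) (f : Vec n × Vec n → ℝ) (i j : Fin n)
    (z : Vec n × Vec n) : ℝ :=
  horD G i (dY j f) z - horD G j (dY i f) z

/-- The component `Rⁱⱼ` of the Jacobi endomorphism `Φ = Rⁱⱼ ∂/∂yⁱ ⊗ dxʲ`. -/
def jacobi (G : Fin n → Vec n × Vec n → ℝ) (i j : Fin n) (z : Vec n × Vec n) : ℝ :=
  2 * dX j (G i) z - sprayD G (dY j (G i)) z - ∑ k, dY k (G i) z * dY j (G k) z

/-- The metric tensor `g_ij = (1/2) ∂²(L²)/∂yⁱ∂yʲ`. -/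
def metricTensor (L : Vec n × Vec n → ℝ) (z : Vec n × Vec n) : Matrix (Fin n) (Fin n) ℝ :=
  Matrix.of fun i j => (1 / 2) * dY i (dY j (fun w => L w ^ 2)) z

/-- The coefficients `Gⁱ = (1/4) gⁱʲ (yᵏ ∂²(L²)/∂xᵏ∂yʲ - ∂(L²)/∂xʲ)` of the geodesic spray of `L`,
that is, of the unique spray with `δ_S L² = 0` (see the two lemmas below). -/
def geodesicCoeff (L : Vec n × Vec n → ℝ) (i : Fin n) (z : Vec n × Vec n) : ℝ :=
  (1 / 4) * ∑ j, (metricTensor L z)⁻¹ i j *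
    (∑ k, z.2 k * dX k (dY j (fun w => L w ^ 2)) z - dX j (fun w => L w ^ 2) z)

theorem eulerLagrangeForm_sq_eq (L : Vec n × Vec n → ℝ) (z : Vec n × Vec n)
    (G : Fin n → Vec n × Vec n → ℝ) (j : Fin n) :
    eulerLagrangeForm G (fun w => L w ^ 2) j z =
      (∑ k, z.2 k * dX k (dY j (fun w => L w ^ 2)) z - dX j (fun w => L w ^ 2) z)
        - 4 * ∑ k, G k z * metricTensor L z k j := by
  have h : ∀ k, G k z * metricTensor L z k j
      = (1 / 2) * (G k z * dY k (dY j (fun w => L w ^ 2)) z) := by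
    intro k
    simp only [metricTensor, Matrix.of_apply]
    ring
  simp only [eulerLagrangeForm, sprayD, h, ← Finset.mul_sum]
  ring

/-- The geodesic coefficients satisfy the Euler-Lagrange equation `δ_S L² = 0`. -/
theorem eulerLagrangeForm_geodesicCoeff (L : Vec n × Vec n → ℝ) (z : Vec n × Vec n)
    (hg : (metricTensor L z).PosDef) (j : Fin n) :
    eulerLagrangeForm (geodesicCoeff L) (fun w => L w ^ 2) j z = 0 := by
  rw [eulerLagrangeForm_sq_eq]
  set g := metricTensor L z with hgdef
  set b : Fin n → ℝ := fun j =>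
    ∑ k, z.2 k * dX k (dY j (fun w => L w ^ 2)) z - dX j (fun w => L w ^ 2) z with hb
  have hsymm : g.transpose = g := by
    have h1 := hg.isHermitian
    rwa [Matrix.IsHermitian, Matrix.conjTranspose_eq_transpose_of_trivial] at h1
  have hdet : IsUnit g.det := (Matrix.isUnit_iff_isUnit_det g).1 hg.isUnit
  have h2 : g.mulVec (g⁻¹.mulVec b) = b := by
    rw [Matrix.mulVec_mulVec, Matrix.mul_nonsing_inv g hdet, Matrix.one_mulVec]
  have h3 : ∀ k, geodesicCoeff L k z = (1 / 4) * g⁻¹.mulVec b k := fun k => rfl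
  have h4 : ∑ k, geodesicCoeff L k z * g k j = (1 / 4) * b j := by
    have h5 : b j = ∑ k, g j k * g⁻¹.mulVec b k := (congrFun h2 j).symm
    rw [h5, Finset.mul_sum]
    refine Finset.sum_congr rfl fun k _ => ?_
    have h6 : g k j = g j k := congrFun (congrFun hsymm j) k
    rw [h3, h6]
    ring
  rw [h4]
  change b j - 4 * (1 / 4 * b j) = 0
  ring

/-- The Euler-Lagrange equation `δ_S L² = 0` determines the spray coefficients. -/
theorem eq_geodesicCoeff (L : Vec n × Vec n → ℝ) (z : Vec n × Vec n)
    (hg : (metricTensor L z).PosDef) (G : Fin n → Vec n × Vec n → ℝ)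
    (hG : ∀ j, eulerLagrangeForm G (fun w => L w ^ 2) j z = 0) (i : Fin n) :
    G i z = geodesicCoeff L i z := by
  have hdet : IsUnit (metricTensor L z).det :=
    (Matrix.isUnit_iff_isUnit_det _).1 hg.isUnit
  have key : Matrix.vecMul (fun k => G k z) (metricTensor L z)
      = Matrix.vecMul (fun k => geodesicCoeff L k z) (metricTensor L z) := by
    funext j
    have h1 := hG j
    have h2 := eulerLagrangeForm_geodesicCoeff L z hg j
    rw [eulerLagrangeForm_sq_eq] at h1 h2
    change ∑ k, G k z * metricTensor L z k j = ∑ k, geodesicCoeff L k z * metricTensor L z k j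
    linarith
  have h3 := congrArg (fun v => Matrix.vecMul v (metricTensor L z)⁻¹) key
  simp only [Matrix.vecMul_vecMul, Matrix.mul_nonsing_inv _ hdet, Matrix.vecMul_one] at h3
  exact congrFun h3 i

end Coordinates

/-! ### Finsler metrics on a manifold -/

section Manifold

variable {n : ℕ} {M : Type*} [TopologicalSpace M] [ChartedSpace (Vec n) M]

/-- The expression of a function on `TM` in the coordinates `(x, y)` induced by a chart `e`:
`(x, y)` stands for the tangent vector `yⁱ ∂/∂xⁱ` at the point `e⁻¹(x)`. -/
def inCoords (e : OpenPartialHomeomorph M (Vec n)) (f : TangentBundle (𝓡 n) M → ℝ)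
    (z : Vec n × Vec n) : ℝ :=
  f ⟨e.symm z.1, mfderiv (𝓡 n) (𝓡 n) e.symm z.1 z.2⟩

/-- The coefficients `Gⁱ` of the geodesic spray of `F` in the coordinates induced by `e`. -/
def spray (F : TangentBundle (𝓡 n) M → ℝ) (e : OpenPartialHomeomorph M (Vec n)) :
    Fin n → Vec n × Vec n → ℝ :=
  geodesicCoeff (inCoords e F)

variable (M) in
/-- `TM` with the zero section removed. -/
def slitTangent : Set (TangentBundle (𝓡 n) M) := {v | v.2 ≠ 0}

/-- Positive `1`-homogeneity along the fibres of `TM` without the zero section. -/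
def PosHomogeneous (f : TangentBundle (𝓡 n) M → ℝ) : Prop :=
  ∀ (p : M) (v : TangentSpace (𝓡 n) p) (r : ℝ), v ≠ 0 → 0 < r → f ⟨p, r • v⟩ = r * f ⟨p, v⟩

/-- A statement about a chart `e` and a point `(x, y)`, `y ≠ 0`, of the induced coordinate domain
in `T₀M`, required for all charts of the smooth structure and all such points. -/
def InAllCoords (M : Type*) [TopologicalSpace M] [ChartedSpace (Vec n) M]
    (p : OpenPartialHomeomorph M (Vec n) → Vec n × Vec n → Prop) : Prop :=
  ∀ e ∈ IsManifold.maximalAtlas (𝓡 n) ∞ M, ∀ z : Vec n × Vec n,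
    z.1 ∈ e.target → z.2 ≠ 0 → p e z

/-- `F` is a Finsler metric on `M`. -/
structure IsFinslerMetric [IsManifold (𝓡 n) ∞ M] (F : TangentBundle (𝓡 n) M → ℝ) : Prop where
  continuous : Continuous F
  pos : ∀ v ∈ slitTangent (n := n) M, 0 < F v
  smooth : ContMDiffOn (𝓡 n).tangent 𝓘(ℝ, ℝ) ∞ F (slitTangent (n := n) M)
  homogeneous : PosHomogeneous F
  posDef : InAllCoords M fun e z => (metricTensor (inCoords e F) z).PosDef

/-- `F` has constant flag curvature: for some constant `κ` the Jacobi endomorphism of its geodesic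
spray is `Φ = κ (F² J - F d_J F ⊗ C)`. -/
def HasConstantFlagCurvature (F : TangentBundle (𝓡 n) M → ℝ) : Prop :=
  ∃ κ : ℝ, InAllCoords M fun e z => ∀ i j : Fin n,
    jacobi (spray F e) i j z =
      κ * (inCoords e F z ^ 2 * (if i = j then 1 else 0)
        - inCoords e F z * dY j (inCoords e F) z * z.2 i)

/-- The regular curve `c`, defined on the open interval `I`, is a geodesic of (the geodesic spray
of) `F`: in all local coordinates `c'' + 2 G(c, c') = 0`. -/
structure IsGeodesicOn (F : TangentBundle (𝓡 n) M → ℝ) (c : ℝ → M) (I : Set ℝ) : Prop where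
  isOpen : IsOpen I
  interval : I.OrdConnected
  smooth : ContMDiffOn 𝓘(ℝ, ℝ) (𝓡 n) ∞ c I
  regular : ∀ e ∈ IsManifold.maximalAtlas (𝓡 n) ∞ M, ∀ t ∈ I, c t ∈ e.source →
    deriv (e ∘ c) t ≠ 0
  equation : ∀ e ∈ IsManifold.maximalAtlas (𝓡 n) ∞ M, ∀ t ∈ I, c t ∈ e.source → ∀ i : Fin n,
    deriv (deriv (e ∘ c)) t i + 2 * spray F e i (e (c t), deriv (e ∘ c) t) = 0

/-- Every geodesic of `F` becomes a geodesic of `F'` after an orientation preserving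
reparametrization. -/
def GeodesicsAreGeodesicsOf (F F' : TangentBundle (𝓡 n) M → ℝ) : Prop :=
  ∀ (c : ℝ → M) (I : Set ℝ), IsGeodesicOn F c I →
    ∃ (J : Set ℝ) (φ : ℝ → ℝ), ContDiffOn ℝ ∞ φ J ∧ (∀ s ∈ J, 0 < deriv φ s) ∧
      Set.BijOn φ J I ∧ IsGeodesicOn F' (c ∘ φ) J

/-- `F` and `F'` are projectively related: their geodesics coincide as oriented non-parametrized
curves. -/
def ProjectivelyRelated (F F' : TangentBundle (𝓡 n) M → ℝ) : Prop :=
  GeodesicsAreGeodesicsOf F F' ∧ GeodesicsAreGeodesicsOf F' F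

/-- `P` is the projective factor from `F` to `F'`: it is smooth and positively `1`-homogeneous on
`T₀M`, and the geodesic sprays `S`, `S'` of `F`, `F'` satisfy `S' = S - 2 P C`, that is,
`G'ⁱ = Gⁱ + P yⁱ`. -/
structure IsProjectiveFactor [IsManifold (𝓡 n) ∞ M] (F F' P : TangentBundle (𝓡 n) M → ℝ) :
    Prop where
  smooth : ContMDiffOn (𝓡 n).tangent 𝓘(ℝ, ℝ) ∞ P (slitTangent (n := n) M)
  homogeneous : PosHomogeneous P
  spray_eq : InAllCoords M fun e z => ∀ i : Fin n,
    spray F' e i z = spray F e i z + inCoords e P z * z.2 i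

/-- The Hamel equation `δ_S P = 0` for the geodesic spray `S` of `F`. -/
def HamelEquation (F P : TangentBundle (𝓡 n) M → ℝ) : Prop :=
  InAllCoords M fun e z => ∀ i : Fin n, eulerLagrangeForm (spray F e) (inCoords e P) i z = 0

/-- The equation `d_h d_J P = 0` for the horizontal projector `h` of the geodesic spray of `F`. -/
def DhDjVanishes (F P : TangentBundle (𝓡 n) M → ℝ) : Prop :=
  InAllCoords M fun e z => ∀ i j : Fin n, dhdJ (spray F e) (inCoords e P) i j z = 0

end Manifold

end FinslerGeometry

end

open FinslerGeometry

/-! Write S, S' for the two sprays and E = δ_S P. Everything is computed in induced coordinates on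
conic domains and then transported to M.

Existence of P. Every vector of T₀M is the initial velocity of a geodesic of F. Comparing
accelerations after reparametrization gives G' = G + c y at each point (`exists_spray_eq_add_smul`).
Applying S' to F' and using S'(F') = 0 with Euler's relation forces c = S(F')/(2F'). This formula is
smooth, homogeneous and chart independent, because S is a genuine vector field: its coefficients are
the unique solution of an invariant variational equation (`fderiv_tangentLift_sprayVec`).

The two Hamel conditions. The form d_h d_J P is half the antisymmetrized y-derivative of E, and
contracting it with y gives E back by homogeneity.

Curvature. Suppose F has constant curvature κ and put ρ = κF² + P² - S(P). The projective change
formula for the Jacobi endomorphism becomes R' = ρ Id - y ⊗ (½ ∂ρ/∂y + (3/2) E)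
(`jacobi_eq_ricciFactor`). If R' has constant curvature κ', then n ≥ 2 allows the multiple of the
identity and the rank one part to be compared separately: ρ = κ'F'², and then the rank one part
leaves E = 0.

Conversely let E = 0. Since F'² is annihilated by S' and by the horizontal derivatives of S',
contracting R' with ∂F'²/∂y gives zero; this says that K = ρ/F'² does not depend on y, and F' has
isotropic curvature K(x). A Schur type argument makes K constant: the identity δ_{S'}ρ = d_{h'}ρ
(`eulerLagrangeForm_sub_horD_ricciFactor`) turns into S'(K) ∂F'²/∂y = 2F'² ∂K/∂x. At each x some y ≠
0 is annihilated by dK, so the left side vanishes there and dK = 0. Connectedness of M finishes the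
argument.

Exchanging F and F' replaces P by -P, and δ_S P = δ_{S'} P, so the statement is symmetric in the two
metrics. -/

noncomputable section

namespace FinslerGeometry

/-! ### Calculus of the operators `∂/∂xⁱ`, `∂/∂yⁱ` and `S` -/

section Calculus

variable {n : ℕ} {Ω : Set (Vec n × Vec n)} {f g : Vec n × Vec n → ℝ} {z : Vec n × Vec n}

theorem contDiffOn_dX (hΩ : IsOpen Ω) (hf : ContDiffOn ℝ ∞ f Ω) (i : Fin n) :
    ContDiffOn ℝ ∞ (dX i f) Ω :=
  (hf.fderiv_of_isOpen hΩ (by simp)).clm_apply contDiffOn_const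

theorem contDiffOn_dY (hΩ : IsOpen Ω) (hf : ContDiffOn ℝ ∞ f Ω) (i : Fin n) :
    ContDiffOn ℝ ∞ (dY i f) Ω :=
  (hf.fderiv_of_isOpen hΩ (by simp)).clm_apply contDiffOn_const

theorem contDiffOn_coord_snd (i : Fin n) :
    ContDiffOn ℝ ∞ (fun w : Vec n × Vec n => w.2 i) Ω := by
  fun_prop

theorem contDiffOn_sprayD (hΩ : IsOpen Ω) {G : Fin n → Vec n × Vec n → ℝ}
    (hG : ∀ k, ContDiffOn ℝ ∞ (G k) Ω) (hf : ContDiffOn ℝ ∞ f Ω) :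
    ContDiffOn ℝ ∞ (sprayD G f) Ω :=
  (ContDiffOn.sum fun k _ => (contDiffOn_coord_snd k).mul (contDiffOn_dX hΩ hf k)).sub
    (contDiffOn_const.mul
      (ContDiffOn.sum fun k _ => (hG k).mul (contDiffOn_dY hΩ hf k)))

theorem contDiffOn_horD (hΩ : IsOpen Ω) {G : Fin n → Vec n × Vec n → ℝ}
    (hG : ∀ k, ContDiffOn ℝ ∞ (G k) Ω) (hf : ContDiffOn ℝ ∞ f Ω) (i : Fin n) :
    ContDiffOn ℝ ∞ (horD G i f) Ω :=
  (contDiffOn_dX hΩ hf i).sub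
    (ContDiffOn.sum fun k _ => (contDiffOn_dY hΩ (hG k) i).mul (contDiffOn_dY hΩ hf k))

theorem _root_.ContDiffOn.diffAt (hf : ContDiffOn ℝ ∞ f Ω) (hΩ : IsOpen Ω) (hz : z ∈ Ω) :
    DifferentiableAt ℝ f z :=
  (hf.contDiffAt (hΩ.mem_nhds hz)).differentiableAt (by simp)

theorem fderiv_eq_sum (f : Vec n × Vec n → ℝ) (z : Vec n × Vec n) (u v : Vec n) :
    fderiv ℝ f z (u, v) = ∑ k, u k * dX k f z + ∑ k, v k * dY k f z := by
  have hu : ∀ u : Vec n, u = ∑ k, u k • EuclideanSpace.single k (1 : ℝ) := by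
    intro u
    ext i
    simp [Finset.sum_apply, Pi.single_apply]
  have h1 : (u, v) = ContinuousLinearMap.inl ℝ (Vec n) (Vec n) u
      + ContinuousLinearMap.inr ℝ (Vec n) (Vec n) v := by simp
  rw [h1, map_add]
  congr 1
  · conv_lhs => rw [hu u]
    simp only [map_sum, map_smul, smul_eq_mul]
    rfl
  · conv_lhs => rw [hu v]
    simp only [map_sum, map_smul, smul_eq_mul]
    rfl

/-- The spray vector field `(y, -2 G)`. -/
def sprayVec (G : Fin n → Vec n × Vec n → ℝ) (z : Vec n × Vec n) : Vec n × Vec n :=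
  (z.2, (-2 : ℝ) • WithLp.toLp 2 fun k => G k z)

theorem sprayD_eq_fderiv (G : Fin n → Vec n × Vec n → ℝ) (f : Vec n × Vec n → ℝ)
    (z : Vec n × Vec n) : sprayD G f z = fderiv ℝ f z (sprayVec G z) := by
  rw [sprayVec, fderiv_eq_sum, sprayD, sub_eq_add_neg]
  simp [Finset.mul_sum, mul_assoc]

theorem fderiv_congr_of_eqOn (hΩ : IsOpen Ω) (h : Set.EqOn f g Ω) (hz : z ∈ Ω) :
    fderiv ℝ f z = fderiv ℝ g z :=
  Filter.EventuallyEq.fderiv_eq (h.eventuallyEq_of_mem (hΩ.mem_nhds hz))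

theorem dX_congr (hΩ : IsOpen Ω) (h : Set.EqOn f g Ω) (hz : z ∈ Ω) (i : Fin n) :
    dX i f z = dX i g z := by rw [dX, dX, fderiv_congr_of_eqOn hΩ h hz]

theorem dY_congr (hΩ : IsOpen Ω) (h : Set.EqOn f g Ω) (hz : z ∈ Ω) (i : Fin n) :
    dY i f z = dY i g z := by rw [dY, dY, fderiv_congr_of_eqOn hΩ h hz]

theorem sprayD_congr (hΩ : IsOpen Ω) (h : Set.EqOn f g Ω) (hz : z ∈ Ω)
    (G : Fin n → Vec n × Vec n → ℝ) : sprayD G f z = sprayD G g z := by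
  rw [sprayD_eq_fderiv, sprayD_eq_fderiv, fderiv_congr_of_eqOn hΩ h hz]

theorem dX_add (hf : DifferentiableAt ℝ f z) (hg : DifferentiableAt ℝ g z) (i : Fin n) :
    dX i (fun w => f w + g w) z = dX i f z + dX i g z := by
  simp [dX, fderiv_fun_add hf hg]

theorem dY_add (hf : DifferentiableAt ℝ f z) (hg : DifferentiableAt ℝ g z) (i : Fin n) :
    dY i (fun w => f w + g w) z = dY i f z + dY i g z := by
  simp [dY, fderiv_fun_add hf hg]

theorem sprayD_add (G : Fin n → Vec n × Vec n → ℝ) (hf : DifferentiableAt ℝ f z)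
    (hg : DifferentiableAt ℝ g z) :
    sprayD G (fun w => f w + g w) z = sprayD G f z + sprayD G g z := by
  simp [sprayD_eq_fderiv, fderiv_fun_add hf hg]

theorem dX_sub (hf : DifferentiableAt ℝ f z) (hg : DifferentiableAt ℝ g z) (i : Fin n) :
    dX i (fun w => f w - g w) z = dX i f z - dX i g z := by
  simp [dX, fderiv_fun_sub hf hg]

theorem dY_sub (hf : DifferentiableAt ℝ f z) (hg : DifferentiableAt ℝ g z) (i : Fin n) :
    dY i (fun w => f w - g w) z = dY i f z - dY i g z := by
  simp [dY, fderiv_fun_sub hf hg]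

theorem sprayD_sub (G : Fin n → Vec n × Vec n → ℝ) (hf : DifferentiableAt ℝ f z)
    (hg : DifferentiableAt ℝ g z) :
    sprayD G (fun w => f w - g w) z = sprayD G f z - sprayD G g z := by
  simp [sprayD_eq_fderiv, fderiv_fun_sub hf hg]

theorem dX_mul (hf : DifferentiableAt ℝ f z) (hg : DifferentiableAt ℝ g z) (i : Fin n) :
    dX i (fun w => f w * g w) z = dX i f z * g z + f z * dX i g z := by
  simp [dX, fderiv_fun_mul hf hg]; ring

theorem dY_mul (hf : DifferentiableAt ℝ f z) (hg : DifferentiableAt ℝ g z) (i : Fin n) :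
    dY i (fun w => f w * g w) z = dY i f z * g z + f z * dY i g z := by
  simp [dY, fderiv_fun_mul hf hg]; ring

theorem sprayD_mul (G : Fin n → Vec n × Vec n → ℝ) (hf : DifferentiableAt ℝ f z)
    (hg : DifferentiableAt ℝ g z) :
    sprayD G (fun w => f w * g w) z = sprayD G f z * g z + f z * sprayD G g z := by
  simp [sprayD_eq_fderiv, fderiv_fun_mul hf hg]; ring

theorem dX_const_mul (hf : DifferentiableAt ℝ f z) (c : ℝ) (i : Fin n) :
    dX i (fun w => c * f w) z = c * dX i f z := by
  simp [dX, fderiv_const_mul hf]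

theorem dY_const_mul (hf : DifferentiableAt ℝ f z) (c : ℝ) (i : Fin n) :
    dY i (fun w => c * f w) z = c * dY i f z := by
  simp [dY, fderiv_const_mul hf]

theorem sprayD_const_mul (G : Fin n → Vec n × Vec n → ℝ) (hf : DifferentiableAt ℝ f z) (c : ℝ) :
    sprayD G (fun w => c * f w) z = c * sprayD G f z := by
  simp [sprayD_eq_fderiv, fderiv_const_mul hf]

theorem dX_sum {h : Fin n → Vec n × Vec n → ℝ} (hh : ∀ k, DifferentiableAt ℝ (h k) z)
    (i : Fin n) : dX i (fun w => ∑ k, h k w) z = ∑ k, dX i (h k) z := by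
  simp [dX, fderiv_fun_sum fun k _ => hh k]

theorem dY_sum {h : Fin n → Vec n × Vec n → ℝ} (hh : ∀ k, DifferentiableAt ℝ (h k) z)
    (i : Fin n) : dY i (fun w => ∑ k, h k w) z = ∑ k, dY i (h k) z := by
  simp [dY, fderiv_fun_sum fun k _ => hh k]

theorem sprayD_sum (G : Fin n → Vec n × Vec n → ℝ) {h : Fin n → Vec n × Vec n → ℝ}
    (hh : ∀ k, DifferentiableAt ℝ (h k) z) :
    sprayD G (fun w => ∑ k, h k w) z = ∑ k, sprayD G (h k) z := by
  simp [sprayD_eq_fderiv, fderiv_fun_sum fun k _ => hh k]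

theorem differentiableAt_coord_snd (k : Fin n) :
    DifferentiableAt ℝ (fun w : Vec n × Vec n => w.2 k) z := by fun_prop

theorem fderiv_coord_snd (k : Fin n) (u v : Vec n) :
    fderiv ℝ (fun w : Vec n × Vec n => w.2 k) z (u, v) = v k := by
  have h : (fun w : Vec n × Vec n => w.2 k)
      = ((EuclideanSpace.proj k : Vec n →L[ℝ] ℝ).comp
          (ContinuousLinearMap.snd ℝ (Vec n) (Vec n))) := rfl
  rw [h, ContinuousLinearMap.fderiv]
  rfl

theorem dX_coord_snd (i k : Fin n) : dX i (fun w : Vec n × Vec n => w.2 k) z = 0 := by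
  rw [dX, fderiv_coord_snd]; rfl

theorem dY_coord_snd (i k : Fin n) :
    dY i (fun w : Vec n × Vec n => w.2 k) z = if k = i then 1 else 0 := by
  rw [dY, fderiv_coord_snd]; simp

theorem sprayD_coord_snd (G : Fin n → Vec n × Vec n → ℝ) (k : Fin n) :
    sprayD G (fun w : Vec n × Vec n => w.2 k) z = -2 * G k z := by
  rw [sprayD_eq_fderiv, sprayVec, fderiv_coord_snd]; simp

theorem fderiv_fderiv_comm (hΩ : IsOpen Ω) (hf : ContDiffOn ℝ ∞ f Ω) (hz : z ∈ Ω)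
    (a b : Vec n × Vec n) :
    fderiv ℝ (fun w => fderiv ℝ f w a) z b = fderiv ℝ (fun w => fderiv ℝ f w b) z a := by
  have hc : ContDiffAt ℝ ∞ f z := hf.contDiffAt (hΩ.mem_nhds hz)
  have hd : DifferentiableAt ℝ (fderiv ℝ f) z :=
    (hc.fderiv_right (m := ∞) (by simp)).differentiableAt (by simp)
  have hs : IsSymmSndFDerivAt ℝ f z := hc.isSymmSndFDerivAt
    (by simpa using WithTop.coe_le_coe.2 (le_top (a := (2 : ℕ∞))))
  have key : ∀ c : Vec n × Vec n, fderiv ℝ (fun w => fderiv ℝ f w c) z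
      = (fderiv ℝ (fderiv ℝ f) z).flip c := by
    intro c
    refine ContinuousLinearMap.ext fun v => ?_
    rw [fderiv_clm_apply hd (differentiableAt_const c)]
    simp
  rw [key, key]
  exact hs b a

theorem dY_dY_comm (hΩ : IsOpen Ω) (hf : ContDiffOn ℝ ∞ f Ω) (hz : z ∈ Ω) (i j : Fin n) :
    dY i (dY j f) z = dY j (dY i f) z := fderiv_fderiv_comm hΩ hf hz _ _

theorem dY_dX_comm (hΩ : IsOpen Ω) (hf : ContDiffOn ℝ ∞ f Ω) (hz : z ∈ Ω) (i j : Fin n) :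
    dY i (dX j f) z = dX j (dY i f) z := fderiv_fderiv_comm hΩ hf hz _ _

theorem dX_dX_comm (hΩ : IsOpen Ω) (hf : ContDiffOn ℝ ∞ f Ω) (hz : z ∈ Ω) (i j : Fin n) :
    dX i (dX j f) z = dX j (dX i f) z := fderiv_fderiv_comm hΩ hf hz _ _

theorem sum_ite_mul_eq (i : Fin n) (a : Fin n → ℝ) :
    ∑ k, (if k = i then (1 : ℝ) else 0) * a k = a i := by simp

/-- Second partial derivatives of `f` commute, so the commutator of `∂/∂xʲ` with the spray only
differentiates the coefficients `G`. -/
theorem dX_sprayD (hΩ : IsOpen Ω) {G : Fin n → Vec n × Vec n → ℝ}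
    (hG : ∀ k, ContDiffOn ℝ ∞ (G k) Ω) (hf : ContDiffOn ℝ ∞ f Ω) (hz : z ∈ Ω) (j : Fin n) :
    dX j (sprayD G f) z = sprayD G (dX j f) z - 2 * ∑ k, dX j (G k) z * dY k f z := by
  have dx := fun k => (contDiffOn_dX hΩ hf k).diffAt hΩ hz
  have dy := fun k => (contDiffOn_dY hΩ hf k).diffAt hΩ hz
  have dG := fun k => (hG k).diffAt hΩ hz
  have d1 := fun k => (differentiableAt_coord_snd (z := z) k).fun_mul (dx k)
  have d2 := fun k => (dG k).fun_mul (dy k)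
  have e : sprayD G f = fun w => ∑ k, w.2 k * dX k f w - 2 * ∑ k, G k w * dY k f w := rfl
  rw [e, dX_sub (.fun_sum fun k _ => d1 k) ((DifferentiableAt.fun_sum fun k _ => d2 k).const_mul _),
    dX_const_mul (.fun_sum fun k _ => d2 k), dX_sum d1, dX_sum d2]
  simp only [dX_mul (differentiableAt_coord_snd _) (dx _), dX_mul (dG _) (dy _), dX_coord_snd,
    Finset.sum_add_distrib, dX_dX_comm hΩ hf hz j, ← dY_dX_comm hΩ hf hz _ j, sprayD]
  simp
  ring

/-- As for `dX_sprayD`; the extra term `∂f/∂xʲ` comes from differentiating the coefficient `yᵏ` of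
the spray. -/
theorem dY_sprayD (hΩ : IsOpen Ω) {G : Fin n → Vec n × Vec n → ℝ}
    (hG : ∀ k, ContDiffOn ℝ ∞ (G k) Ω) (hf : ContDiffOn ℝ ∞ f Ω) (hz : z ∈ Ω) (j : Fin n) :
    dY j (sprayD G f) z
      = sprayD G (dY j f) z + dX j f z - 2 * ∑ k, dY j (G k) z * dY k f z := by
  have dx := fun k => (contDiffOn_dX hΩ hf k).diffAt hΩ hz
  have dy := fun k => (contDiffOn_dY hΩ hf k).diffAt hΩ hz
  have dG := fun k => (hG k).diffAt hΩ hz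
  have d1 := fun k => (differentiableAt_coord_snd (z := z) k).fun_mul (dx k)
  have d2 := fun k => (dG k).fun_mul (dy k)
  have e : sprayD G f = fun w => ∑ k, w.2 k * dX k f w - 2 * ∑ k, G k w * dY k f w := rfl
  rw [e, dY_sub (.fun_sum fun k _ => d1 k) ((DifferentiableAt.fun_sum fun k _ => d2 k).const_mul _),
    dY_const_mul (.fun_sum fun k _ => d2 k), dY_sum d1, dY_sum d2]
  simp only [dY_mul (differentiableAt_coord_snd _) (dx _), dY_mul (dG _) (dy _), dY_coord_snd,
    Finset.sum_add_distrib, dY_dY_comm hΩ hf hz j, dY_dX_comm hΩ hf hz j, sprayD,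
    sum_ite_mul_eq]
  ring

/-- `∂(S f)/∂yʲ = (δ_S f)_j + 2 δf/δxʲ`. -/
theorem dY_sprayD_eq (hΩ : IsOpen Ω) {G : Fin n → Vec n × Vec n → ℝ}
    (hG : ∀ k, ContDiffOn ℝ ∞ (G k) Ω) (hf : ContDiffOn ℝ ∞ f Ω) (hz : z ∈ Ω) (j : Fin n) :
    dY j (sprayD G f) z = eulerLagrangeForm G f j z + 2 * horD G j f z := by
  rw [dY_sprayD hΩ hG hf hz, eulerLagrangeForm, horD]
  ring

/-- `Rᵏⱼ ∂f/∂yᵏ = S(δf/δxʲ) - δ(S f)/δxʲ - Gᵏⱼ δf/δxᵏ`. -/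
theorem sum_jacobi_mul_dY (hΩ : IsOpen Ω) {G : Fin n → Vec n × Vec n → ℝ}
    (hG : ∀ k, ContDiffOn ℝ ∞ (G k) Ω) (hf : ContDiffOn ℝ ∞ f Ω) (hz : z ∈ Ω) (j : Fin n) :
    ∑ k, jacobi G k j z * dY k f z = sprayD G (horD G j f) z - horD G j (sprayD G f) z
      - ∑ k, dY j (G k) z * horD G k f z := by
  have dx := fun k => (contDiffOn_dX hΩ hf k).diffAt hΩ hz
  have dy := fun k => (contDiffOn_dY hΩ hf k).diffAt hΩ hz
  have dG := fun k => (contDiffOn_dY hΩ (hG k) j).diffAt hΩ hz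
  have d2 := fun k => (dG k).fun_mul (dy k)
  have e : horD G j f = fun w => dX j f w - ∑ k, dY j (G k) w * dY k f w := rfl
  -- The right side is the commutator of `S` and `δ/δxʲ`, corrected by its horizontal part. In `e1`
  -- and `e2` the terms with second derivatives of `f` agree and cancel; the first order terms in
  -- `∂f/∂x` cancel against `e3`.
  have e1 : sprayD G (horD G j f) z = sprayD G (dX j f) z
      - (∑ k, sprayD G (dY j (G k)) z * dY k f z
        + ∑ k, dY j (G k) z * sprayD G (dY k f) z) := by
    rw [e, sprayD_sub G (dx j) (.fun_sum fun k _ => d2 k), sprayD_sum G d2]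
    simp only [sprayD_mul G (dG _) (dy _), Finset.sum_add_distrib]
  have e2 : horD G j (sprayD G f) z
      = sprayD G (dX j f) z - 2 * ∑ k, dX j (G k) z * dY k f z
        - (∑ k, dY j (G k) z * sprayD G (dY k f) z + ∑ k, dY j (G k) z * dX k f z
          - 2 * ∑ k, ∑ l, dY j (G k) z * dY k (G l) z * dY l f z) := by
    rw [horD, dX_sprayD hΩ hG hf hz]
    simp only [dY_sprayD hΩ hG hf hz, mul_add, mul_sub, Finset.sum_add_distrib,
      Finset.sum_sub_distrib, Finset.mul_sum]
    congr 2
    refine Finset.sum_congr rfl fun k _ => Finset.sum_congr rfl fun l _ => by ring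
  have e3 : ∑ k, dY j (G k) z * horD G k f z = ∑ k, dY j (G k) z * dX k f z
      - ∑ k, ∑ l, dY j (G k) z * dY k (G l) z * dY l f z := by
    simp only [horD, mul_sub, Finset.sum_sub_distrib, Finset.mul_sum, mul_assoc]
  have e4 : ∑ k, jacobi G k j z * dY k f z = 2 * ∑ k, dX j (G k) z * dY k f z
      - ∑ k, sprayD G (dY j (G k)) z * dY k f z
      - ∑ k, ∑ l, dY j (G k) z * dY k (G l) z * dY l f z := by
    simp only [jacobi, sub_mul, Finset.sum_sub_distrib, Finset.mul_sum, Finset.sum_mul]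
    rw [Finset.sum_comm (f := fun k l => dY j (G k) z * dY k (G l) z * dY l f z)]
    congr 1
    · congr 1
      exact Finset.sum_congr rfl fun k _ => by ring
    · exact Finset.sum_congr rfl fun k _ => Finset.sum_congr rfl fun l _ => by ring
  rw [e1, e2, e3, e4]
  ring

end Calculus

/-! ### Positively homogeneous functions on conic domains -/

section Homogeneity

variable {n : ℕ} {Ω : Set (Vec n × Vec n)} {f g : Vec n × Vec n → ℝ} {z : Vec n × Vec n}

/-- `Ω` is invariant under positive rescaling of `y`. -/
def IsConic (Ω : Set (Vec n × Vec n)) : Prop :=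
  ∀ z ∈ Ω, ∀ r : ℝ, 0 < r → (z.1, r • z.2) ∈ Ω

/-- Positive `k`-homogeneity in `y` on `Ω`. -/
def HomogOn (k : ℕ) (f : Vec n × Vec n → ℝ) (Ω : Set (Vec n × Vec n)) : Prop :=
  ∀ z ∈ Ω, ∀ r : ℝ, 0 < r → f (z.1, r • z.2) = r ^ k * f z

/-- Chain rule for `f ∘ σ = rᵏ f`, where `σ (x, y) = (x, r y)`. It yields the homogeneity degree of
every derivative below. -/
theorem HomogOn.fderiv_scale (hΩ : IsOpen Ω) (hc : IsConic Ω) {k : ℕ} (hh : HomogOn k f Ω)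
    (hf : ContDiffOn ℝ ∞ f Ω) (hz : z ∈ Ω) {r : ℝ} (hr : 0 < r) (u v : Vec n) :
    fderiv ℝ f (z.1, r • z.2) (u, r • v) = r ^ k * fderiv ℝ f z (u, v) := by
  set σ : Vec n × Vec n →L[ℝ] Vec n × Vec n :=
    (ContinuousLinearMap.fst ℝ (Vec n) (Vec n)).prod
      (r • ContinuousLinearMap.snd ℝ (Vec n) (Vec n)) with hσ
  have hσz : ∀ w, σ w = (w.1, r • w.2) := fun w => rfl
  have h1 : HasFDerivAt (f ∘ σ) ((fderiv ℝ f (σ z)).comp σ) z := by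
    refine HasFDerivAt.comp z ?_ σ.hasFDerivAt
    exact (hf.diffAt hΩ (hc z hz r hr)).hasFDerivAt
  have h2 : fderiv ℝ (f ∘ σ) z = fderiv ℝ (fun w => r ^ k * f w) z :=
    fderiv_congr_of_eqOn hΩ (fun w hw => hh w hw r hr) hz
  rw [h1.fderiv, fderiv_const_mul (hf.diffAt hΩ hz)] at h2
  exact congrArg (fun A : Vec n × Vec n →L[ℝ] ℝ => A (u, v)) h2

theorem HomogOn.partialX (hΩ : IsOpen Ω) (hc : IsConic Ω) {k : ℕ} (hh : HomogOn k f Ω)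
    (hf : ContDiffOn ℝ ∞ f Ω) (i : Fin n) : HomogOn k (dX i f) Ω := by
  intro z hz r hr
  have h := hh.fderiv_scale hΩ hc hf hz hr (EuclideanSpace.single i 1) 0
  rwa [smul_zero] at h

theorem HomogOn.partialY (hΩ : IsOpen Ω) (hc : IsConic Ω) {k : ℕ} (hh : HomogOn (k + 1) f Ω)
    (hf : ContDiffOn ℝ ∞ f Ω) (i : Fin n) : HomogOn k (dY i f) Ω := by
  intro z hz r hr
  have h := hh.fderiv_scale hΩ hc hf hz hr 0 (EuclideanSpace.single i 1)
  have h2 : ((0 : Vec n), r • EuclideanSpace.single i (1 : ℝ))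
      = r • ((0 : Vec n), EuclideanSpace.single i (1 : ℝ)) := by simp
  rw [h2, map_smul, smul_eq_mul, pow_succ', mul_assoc] at h
  exact mul_left_cancel₀ hr.ne' h

/-- Euler's relation. -/
theorem HomogOn.euler (hΩ : IsOpen Ω) {k : ℕ} (hh : HomogOn k f Ω)
    (hf : ContDiffOn ℝ ∞ f Ω) (hz : z ∈ Ω) : ∑ i, z.2 i * dY i f z = k * f z := by
  have h0 := fderiv_eq_sum f z 0 z.2
  simp only [PiLp.zero_apply, zero_mul, Finset.sum_const_zero, zero_add] at h0
  rw [← h0]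
  have hl : HasDerivAt (fun r : ℝ => (z.1, r • z.2)) ((0 : Vec n), z.2) 1 := by
    refine (hasDerivAt_const _ _).prodMk ?_
    simpa using (hasDerivAt_id (1 : ℝ)).smul_const z.2
  have h1 : HasDerivAt (fun r : ℝ => f (z.1, r • z.2)) (fderiv ℝ f z (0, z.2)) 1 := by
    have h3 : HasFDerivAt f (fderiv ℝ f z) ((fun r : ℝ => (z.1, r • z.2)) 1) := by
      simpa using (hf.diffAt hΩ hz).hasFDerivAt
    exact h3.comp_hasDerivAt 1 hl
  have h2 : HasDerivAt (fun r : ℝ => r ^ k * f z) (k * f z) 1 := by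
    simpa using (hasDerivAt_pow k (1 : ℝ)).mul_const (f z)
  refine h1.unique (h2.congr_of_eventuallyEq ?_)
  filter_upwards [lt_mem_nhds (one_pos (α := ℝ))] with r hr
  exact hh z hz r hr

/-- With 2-homogeneous coefficients, the spray at `(x, r y)` is `r` times the image of the spray at
`(x, y)` under the scaling of `y`; the factor `r` raises the degree by one. -/
theorem HomogOn.along_spray (hΩ : IsOpen Ω) (hc : IsConic Ω) {G : Fin n → Vec n × Vec n → ℝ}
    (hG : ∀ k, HomogOn 2 (G k) Ω) {k : ℕ} (hh : HomogOn k f Ω) (hf : ContDiffOn ℝ ∞ f Ω) :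
    HomogOn (k + 1) (sprayD G f) Ω := by
  intro z hz r hr
  have h := hh.fderiv_scale hΩ hc hf hz hr z.2 ((-2 : ℝ) • WithLp.toLp 2 fun k => G k z)
  have e : sprayVec G (z.1, r • z.2)
      = r • (z.2, r • (-2 : ℝ) • WithLp.toLp 2 fun k => G k z) := by
    ext i <;> simp [sprayVec, hG _ z hz r hr]
    ring
  rw [sprayD_eq_fderiv, sprayD_eq_fderiv, e, map_smul, h, sprayVec, smul_eq_mul]
  ring

/-- `yʲ (δ_S f)_j = (k - 1) S f` for `k`-homogeneous `f`. -/
theorem sum_mul_eulerLagrangeForm (hΩ : IsOpen Ω) {G : Fin n → Vec n × Vec n → ℝ} {k : ℕ}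
    (hh : HomogOn k f Ω) (hf : ContDiffOn ℝ ∞ f Ω) (hz : z ∈ Ω) :
    ∑ j, z.2 j * eulerLagrangeForm G f j z = (k - 1) * sprayD G f z := by
  have dy := fun k => (contDiffOn_dY hΩ hf k).diffAt hΩ hz
  -- Apply the spray to both sides of Euler's relation; the derivative of `yʲ` contributes `-2 Gʲ`.
  have h1 : sprayD G (fun w => ∑ j, w.2 j * dY j f w) z = k * sprayD G f z := by
    rw [sprayD_congr hΩ (fun w hw => hh.euler hΩ hf hw) hz,
      sprayD_const_mul G (hf.diffAt hΩ hz)]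
  rw [sprayD_sum G fun j => (differentiableAt_coord_snd j).fun_mul (dy j)] at h1
  simp only [sprayD_mul G (differentiableAt_coord_snd _) (dy _), sprayD_coord_snd,
    Finset.sum_add_distrib] at h1
  have h2 : ∑ j, -2 * G j z * dY j f z = -2 * ∑ j, G j z * dY j f z := by
    simp only [Finset.mul_sum, mul_assoc]
  have h3 : sprayD G f z = ∑ k, z.2 k * dX k f z - 2 * ∑ k, G k z * dY k f z := rfl
  simp only [eulerLagrangeForm, mul_sub, Finset.sum_sub_distrib]
  linarith

end Homogeneity

/-! ### Finsler functions in coordinates -/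

section LocalFinsler

variable {n : ℕ} {Ω : Set (Vec n × Vec n)} {L : Vec n × Vec n → ℝ} {z : Vec n × Vec n}

/-- `L` is the coordinate expression of a Finsler metric on the domain `Ω`. -/
structure IsLocalFinsler (L : Vec n × Vec n → ℝ) (Ω : Set (Vec n × Vec n)) : Prop where
  isOpen : IsOpen Ω
  conic : IsConic Ω
  smooth : ContDiffOn ℝ ∞ L Ω
  pos : ∀ z ∈ Ω, 0 < L z
  homog : HomogOn 1 L Ω
  posDef : ∀ z ∈ Ω, (metricTensor L z).PosDef

namespace IsLocalFinsler

theorem smooth_sq (h : IsLocalFinsler L Ω) : ContDiffOn ℝ ∞ (fun w => L w ^ 2) Ω :=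
  h.smooth.pow 2

theorem homog_sq (h : IsLocalFinsler L Ω) : HomogOn 2 (fun w => L w ^ 2) Ω := by
  intro z hz r hr
  simp only [h.homog z hz r hr]
  ring

theorem metricTensor_homog (h : IsLocalFinsler L Ω) (hz : z ∈ Ω) {r : ℝ} (hr : 0 < r) :
    metricTensor L (z.1, r • z.2) = metricTensor L z := by
  ext i j
  have h1 := ((h.homog_sq.partialY h.isOpen h.conic h.smooth_sq j).partialY h.isOpen h.conic
    (contDiffOn_dY h.isOpen h.smooth_sq j) i) z hz r hr
  simp only [metricTensor, Matrix.of_apply, h1]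
  ring

theorem homog_geodesicCoeff (h : IsLocalFinsler L Ω) (i : Fin n) :
    HomogOn 2 (geodesicCoeff L i) Ω := by
  intro z hz r hr
  have h1 := fun j k => ((h.homog_sq.partialY h.isOpen h.conic h.smooth_sq j).partialX h.isOpen h.conic
    (contDiffOn_dY h.isOpen h.smooth_sq j) k) z hz r hr
  have h2 := fun j => (h.homog_sq.partialX h.isOpen h.conic h.smooth_sq j) z hz r hr
  have h3 : ∀ j, ∑ k, (r • z.2) k * dX k (dY j fun w => L w ^ 2) (z.1, r • z.2)
      = r ^ 2 * ∑ k, z.2 k * dX k (dY j fun w => L w ^ 2) z := by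
    intro j
    rw [Finset.mul_sum]
    refine Finset.sum_congr rfl fun k _ => ?_
    rw [h1, PiLp.smul_apply, smul_eq_mul]
    ring
  simp only [geodesicCoeff, h.metricTensor_homog hz hr, h3, h2, ← mul_sub]
  rw [mul_left_comm, Finset.mul_sum (a := r ^ 2)]
  congr 1
  exact Finset.sum_congr rfl fun j _ => by ring

theorem smooth_metricTensor (h : IsLocalFinsler L Ω) (i j : Fin n) :
    ContDiffOn ℝ ∞ (fun w => metricTensor L w i j) Ω :=
  contDiffOn_const.mul (contDiffOn_dY h.isOpen (contDiffOn_dY h.isOpen h.smooth_sq j) i)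

theorem _root_.ContDiffOn.matrix_det {m : ℕ} {A : Vec n × Vec n → Matrix (Fin m) (Fin m) ℝ}
    (hA : ∀ i j, ContDiffOn ℝ ∞ (fun w => A w i j) Ω) : ContDiffOn ℝ ∞ (fun w => (A w).det) Ω := by
  simp only [Matrix.det_apply']
  refine ContDiffOn.sum fun (σ : Equiv.Perm (Fin m)) _ => ContDiffOn.mul contDiffOn_const ?_
  exact contDiffOn_prod fun i _ => hA (σ i) i

/-- Cramer's rule: each adjugate entry is the determinant of the matrix with one row replaced by a
constant row. -/
theorem _root_.ContDiffOn.matrix_inv {m : ℕ} {A : Vec n × Vec n → Matrix (Fin m) (Fin m) ℝ}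
    (hA : ∀ i j, ContDiffOn ℝ ∞ (fun w => A w i j) Ω) (hd : ∀ w ∈ Ω, (A w).det ≠ 0)
    (i j : Fin m) : ContDiffOn ℝ ∞ (fun w => (A w)⁻¹ i j) Ω := by
  simp only [Matrix.inv_def, Matrix.smul_apply, Ring.inverse_eq_inv', smul_eq_mul,
    Matrix.adjugate_apply]
  refine ((ContDiffOn.matrix_det hA).inv hd).mul (ContDiffOn.matrix_det fun k l => ?_)
  by_cases hk : k = j
  · subst hk
    simpa using contDiffOn_const
  · simpa [Matrix.updateRow_ne hk] using hA k l

theorem smooth_geodesicCoeff (h : IsLocalFinsler L Ω) (i : Fin n) :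
    ContDiffOn ℝ ∞ (geodesicCoeff L i) Ω := by
  refine ContDiffOn.mul contDiffOn_const (ContDiffOn.sum fun (j : Fin n) _ => ?_)
  refine (ContDiffOn.matrix_inv h.smooth_metricTensor
    (fun w hw => (h.posDef w hw).det_pos.ne') i j).mul ?_
  refine (ContDiffOn.sum fun k _ => ?_).sub (contDiffOn_dX h.isOpen h.smooth_sq j)
  exact (contDiffOn_coord_snd k).mul
    (contDiffOn_dX h.isOpen (contDiffOn_dY h.isOpen h.smooth_sq j) k)

/-- Conservation of energy: contract the Euler-Lagrange equation with `y` and use that `L²` has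
degree 2. -/
theorem sprayD_sq (h : IsLocalFinsler L Ω) (hz : z ∈ Ω) :
    sprayD (geodesicCoeff L) (fun w => L w ^ 2) z = 0 := by
  have h1 := sum_mul_eulerLagrangeForm (G := geodesicCoeff L) h.isOpen h.homog_sq h.smooth_sq hz
  simp only [eulerLagrangeForm_geodesicCoeff L z (h.posDef z hz), mul_zero,
    Finset.sum_const_zero] at h1
  norm_num at h1
  exact h1.symm

theorem sprayD_self (h : IsLocalFinsler L Ω) (hz : z ∈ Ω) :
    sprayD (geodesicCoeff L) L z = 0 := by
  have h1 := h.sprayD_sq hz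
  have hd := h.smooth.diffAt h.isOpen hz
  simp only [pow_two] at h1
  rw [sprayD_mul _ hd hd] at h1
  have h2 := h.pos z hz
  have h3 : sprayD (geodesicCoeff L) L z * (2 * L z) = 0 := by linarith
  exact (mul_eq_zero.1 h3).resolve_right (by positivity)

/-- Differentiating `S(L²) = 0` in `yʲ` gives `δ_S L² + 2 d_h L² = 0`, and the first term vanishes.
-/
theorem horD_sq (h : IsLocalFinsler L Ω) (hz : z ∈ Ω) (j : Fin n) :
    horD (geodesicCoeff L) j (fun w => L w ^ 2) z = 0 := by
  have h1 := dY_sprayD_eq h.isOpen h.smooth_geodesicCoeff h.smooth_sq hz j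
  have h2 : dY j (sprayD (geodesicCoeff L) fun w => L w ^ 2) z = dY j (fun _ => (0 : ℝ)) z :=
    dY_congr h.isOpen (fun w hw => h.sprayD_sq hw) hz j
  have h3 : dY j (fun _ : Vec n × Vec n => (0 : ℝ)) z = 0 := by simp [dY]
  rw [eulerLagrangeForm_geodesicCoeff L z (h.posDef z hz)] at h1
  linarith

/-- The contraction is a commutator expression in `S` and `δ/δxʲ`, all of which annihilate `L²`.
This is the constraint that a Jacobi endomorphism satisfies by coming from a metric. -/
theorem sum_jacobi_mul_dY_sq (h : IsLocalFinsler L Ω) (hz : z ∈ Ω) (j : Fin n) :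
    ∑ k, jacobi (geodesicCoeff L) k j z * dY k (fun w => L w ^ 2) z = 0 := by
  have hS : ∀ f : Vec n × Vec n → ℝ, Set.EqOn f (fun _ => 0) Ω → ∀ v, fderiv ℝ f z v = 0 := by
    intro f hf v
    rw [fderiv_congr_of_eqOn h.isOpen hf hz]
    simp
  rw [sum_jacobi_mul_dY h.isOpen h.smooth_geodesicCoeff h.smooth_sq hz j, sprayD_eq_fderiv,
    hS _ fun w hw => h.horD_sq hw j, horD]
  simp only [dX, dY, hS _ fun w hw => h.sprayD_sq hw, h.horD_sq hz]
  simp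

end IsLocalFinsler

end LocalFinsler

/-! ### The Hamel equation and the projective change of a spray -/

section ProjectiveChange

variable {n : ℕ} {Ω : Set (Vec n × Vec n)} {G G' : Fin n → Vec n × Vec n → ℝ}
  {f P : Vec n × Vec n → ℝ} {z : Vec n × Vec n}

theorem contDiffOn_eulerLagrangeForm (hΩ : IsOpen Ω) (hG : ∀ k, ContDiffOn ℝ ∞ (G k) Ω)
    (hf : ContDiffOn ℝ ∞ f Ω) (j : Fin n) : ContDiffOn ℝ ∞ (eulerLagrangeForm G f j) Ω :=
  (contDiffOn_sprayD hΩ hG (contDiffOn_dY hΩ hf j)).sub (contDiffOn_dX hΩ hf j)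

/-- In the antisymmetrization, the term `S(∂²f/∂yⁱ∂yʲ)` is symmetric and drops out; the terms in
`∂²f/∂xⁱ∂yʲ` double. -/
theorem dhdJ_eq_dY_eulerLagrangeForm (hΩ : IsOpen Ω) (hG : ∀ k, ContDiffOn ℝ ∞ (G k) Ω)
    (hf : ContDiffOn ℝ ∞ f Ω) (hz : z ∈ Ω) (i j : Fin n) :
    2 * dhdJ G f i j z
      = dY i (eulerLagrangeForm G f j) z - dY j (eulerLagrangeForm G f i) z := by
  have key : ∀ i j, dY i (eulerLagrangeForm G f j) z
      = sprayD G (dY i (dY j f)) z + dX i (dY j f) z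
        - 2 * ∑ k, dY i (G k) z * dY k (dY j f) z - dX j (dY i f) z := by
    intro i j
    have e : eulerLagrangeForm G f j = fun w => sprayD G (dY j f) w - dX j f w := rfl
    rw [e, dY_sub ((contDiffOn_sprayD hΩ hG (contDiffOn_dY hΩ hf j)).diffAt hΩ hz)
      ((contDiffOn_dX hΩ hf j).diffAt hΩ hz), dY_sprayD hΩ hG (contDiffOn_dY hΩ hf j) hz,
      dY_dX_comm hΩ hf hz]
  rw [key, key, sprayD_congr hΩ (fun w hw => dY_dY_comm hΩ hf hw i j) hz, dhdJ, horD, horD]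
  ring

/-- Let `E = δ_S f`. Since `yⁱ Eᵢ = 0` in degree 1, differentiating gives `yⁱ ∂Eᵢ/∂yʲ = -Eⱼ`, while
`yⁱ ∂Eⱼ/∂yⁱ = Eⱼ` because `Eⱼ` is 1-homogeneous. The difference is `2 Eⱼ`. -/
theorem sum_mul_dhdJ (hΩ : IsOpen Ω) (hc : IsConic Ω) (hG : ∀ k, ContDiffOn ℝ ∞ (G k) Ω)
    (hGh : ∀ k, HomogOn 2 (G k) Ω) (hf : ContDiffOn ℝ ∞ f Ω) (hfh : HomogOn 1 f Ω)
    (hz : z ∈ Ω) (j : Fin n) :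
    ∑ i, z.2 i * dhdJ G f i j z = eulerLagrangeForm G f j z := by
  have hE := fun j => contDiffOn_eulerLagrangeForm hΩ hG hf j
  have h0 : ∀ w ∈ Ω, ∑ i, w.2 i * eulerLagrangeForm G f i w = 0 := by
    intro w hw
    rw [sum_mul_eulerLagrangeForm hΩ hfh hf hw]
    simp
  have h1 : dY j (fun w => ∑ i, w.2 i * eulerLagrangeForm G f i w) z = 0 := by
    rw [dY_congr hΩ (g := fun _ => 0) h0 hz]
    simp [dY]
  rw [dY_sum fun i => (differentiableAt_coord_snd i).fun_mul ((hE i).diffAt hΩ hz)] at h1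
  simp only [dY_mul (differentiableAt_coord_snd _) ((hE _).diffAt hΩ hz), dY_coord_snd,
    Finset.sum_add_distrib, sum_ite_mul_eq] at h1
  have hEh : HomogOn 1 (eulerLagrangeForm G f j) Ω := by
    intro w hw r hr
    have a := ((hfh.partialY hΩ hc hf j).along_spray hΩ hc hGh (contDiffOn_dY hΩ hf j)) w hw r hr
    have b := (hfh.partialX hΩ hc hf j) w hw r hr
    simp only [eulerLagrangeForm, a, b]
    ring
  have h2 := hEh.euler hΩ (hE j) hz
  have h3 : 2 * ∑ i, z.2 i * dhdJ G f i j z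
      = ∑ i, z.2 i * dY i (eulerLagrangeForm G f j) z
        - ∑ i, z.2 i * dY j (eulerLagrangeForm G f i) z := by
    rw [Finset.mul_sum, ← Finset.sum_sub_distrib]
    refine Finset.sum_congr rfl fun i _ => ?_
    rw [mul_left_comm, dhdJ_eq_dY_eulerLagrangeForm hΩ hG hf hz]
    ring
  push_cast at h2
  linarith

/-- The two forms of the Hamel equation are equivalent for `1`-homogeneous functions. -/
theorem eulerLagrangeForm_eq_zero_iff_dhdJ (hΩ : IsOpen Ω) (hc : IsConic Ω)
    (hG : ∀ k, ContDiffOn ℝ ∞ (G k) Ω) (hGh : ∀ k, HomogOn 2 (G k) Ω)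
    (hf : ContDiffOn ℝ ∞ f Ω) (hfh : HomogOn 1 f Ω) :
    (∀ z ∈ Ω, ∀ i, eulerLagrangeForm G f i z = 0) ↔ ∀ z ∈ Ω, ∀ i j, dhdJ G f i j z = 0 := by
  constructor
  · intro h z hz i j
    have h1 := dhdJ_eq_dY_eulerLagrangeForm hΩ hG hf hz i j
    rw [dY_congr hΩ (g := fun _ => 0) (fun w hw => h w hw j) hz,
      dY_congr hΩ (g := fun _ => 0) (fun w hw => h w hw i) hz] at h1
    simpa [dY] using h1
  · intro h z hz i
    rw [← sum_mul_dhdJ hΩ hc hG hGh hf hfh hz i]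
    simp [h z hz]

/-- `P` is a projective factor from the spray `G` to the spray `G'` on the domain `Ω`. -/
structure IsLocalFactor (G G' : Fin n → Vec n × Vec n → ℝ) (P : Vec n × Vec n → ℝ)
    (Ω : Set (Vec n × Vec n)) : Prop where
  isOpen : IsOpen Ω
  conic : IsConic Ω
  smooth_spray : ∀ k, ContDiffOn ℝ ∞ (G k) Ω
  homog_spray : ∀ k, HomogOn 2 (G k) Ω
  smooth : ContDiffOn ℝ ∞ P Ω
  homog : HomogOn 1 P Ω
  spray_eq : ∀ z ∈ Ω, ∀ k, G' k z = G k z + P z * z.2 k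

theorem sprayD_of_eq_add_smul {c : ℝ} (h : ∀ k, G' k z = G k z + c * z.2 k)
    (f : Vec n × Vec n → ℝ) :
    sprayD G' f z = sprayD G f z - 2 * c * ∑ k, z.2 k * dY k f z := by
  have h1 : ∑ k, G' k z * dY k f z
      = ∑ k, G k z * dY k f z + c * ∑ k, z.2 k * dY k f z := by
    rw [Finset.mul_sum, ← Finset.sum_add_distrib]
    refine Finset.sum_congr rfl fun k _ => ?_
    rw [h]
    ring
  rw [sprayD, sprayD, h1]
  ring

namespace IsLocalFactor

theorem sprayD_eq (h : IsLocalFactor G G' P Ω) (hz : z ∈ Ω) (f : Vec n × Vec n → ℝ) :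
    sprayD G' f z = sprayD G f z - 2 * P z * ∑ k, z.2 k * dY k f z :=
  sprayD_of_eq_add_smul (h.spray_eq z hz) f

theorem sprayD_eq_of_homogOn (h : IsLocalFactor G G' P Ω) (hz : z ∈ Ω) {k : ℕ}
    (hf : ContDiffOn ℝ ∞ f Ω) (hfh : HomogOn k f Ω) :
    sprayD G' f z = sprayD G f z - 2 * P z * (k * f z) := by
  rw [h.sprayD_eq hz, hfh.euler h.isOpen hf hz]

theorem dY_spray (h : IsLocalFactor G G' P Ω) (hz : z ∈ Ω) (i j : Fin n) :
    dY j (G' i) z = dY j (G i) z + dY j P z * z.2 i + P z * (if i = j then 1 else 0) := by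
  have dG := (h.smooth_spray i).diffAt h.isOpen hz
  have dP := h.smooth.diffAt h.isOpen hz
  rw [dY_congr h.isOpen (g := fun w => G i w + P w * w.2 i) (fun w hw => h.spray_eq w hw i) hz,
    dY_add dG (dP.fun_mul (differentiableAt_coord_snd i)), dY_mul dP (differentiableAt_coord_snd i),
    dY_coord_snd]
  ring

theorem dX_spray (h : IsLocalFactor G G' P Ω) (hz : z ∈ Ω) (i j : Fin n) :
    dX j (G' i) z = dX j (G i) z + dX j P z * z.2 i := by
  have dG := (h.smooth_spray i).diffAt h.isOpen hz
  have dP := h.smooth.diffAt h.isOpen hz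
  rw [dX_congr h.isOpen (g := fun w => G i w + P w * w.2 i) (fun w hw => h.spray_eq w hw i) hz,
    dX_add dG (dP.fun_mul (differentiableAt_coord_snd i)), dX_mul dP (differentiableAt_coord_snd i),
    dX_coord_snd]
  ring

/-- The Euler-Lagrange form of the projective factor does not depend on the spray. -/
theorem eulerLagrangeForm_eq (h : IsLocalFactor G G' P Ω) (hz : z ∈ Ω) (j : Fin n) :
    eulerLagrangeForm G' P j z = eulerLagrangeForm G P j z := by
  -- The derivative `∂P/∂yʲ` is 0-homogeneous, so the correction `-2 P C` of the spray annihilates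
  -- it.
  rw [eulerLagrangeForm, eulerLagrangeForm, h.sprayD_eq_of_homogOn hz
    (contDiffOn_dY h.isOpen h.smooth j) (h.homog.partialY h.isOpen h.conic h.smooth j)]
  simp

/-- The change of the Jacobi endomorphism under a projective change of the spray. -/
theorem jacobi_eq (h : IsLocalFactor G G' P Ω) (hz : z ∈ Ω) (i j : Fin n) :
    jacobi G' i j z = jacobi G i j z
      + (P z ^ 2 - sprayD G P z) * (if i = j then 1 else 0)
      + z.2 i * (horD G j P z - eulerLagrangeForm G P j z - P z * dY j P z) := by
  have hΩ := h.isOpen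
  have sG := fun k => h.smooth_spray k
  have sP := h.smooth
  have dGj := (contDiffOn_dY hΩ (sG i) j).diffAt hΩ hz
  have dPj := (contDiffOn_dY hΩ sP j).diffAt hΩ hz
  have dP := sP.diffAt hΩ hz
  have hGj := fun i j => (h.homog_spray i).partialY hΩ h.conic (sG i) j
  have hPj := h.homog.partialY hΩ h.conic sP j
  -- The function `∂G'ⁱ/∂yʲ` is 1-homogeneous, so passing from `S'` to `S` costs `2 P` times the
  -- function itself.
  have e1 : sprayD G' (dY j (G' i)) z = sprayD G (dY j (G i)) z + sprayD G (dY j P) z * z.2 i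
      - 2 * dY j P z * G i z + sprayD G P z * (if i = j then 1 else 0)
      - 2 * P z * (dY j (G i) z + dY j P z * z.2 i + P z * (if i = j then 1 else 0)) := by
    rw [sprayD_congr hΩ (fun w hw => h.dY_spray hw i j) hz, h.sprayD_eq_of_homogOn hz (k := 1)]
    · rw [sprayD_add G (dGj.fun_add (dPj.fun_mul (differentiableAt_coord_snd i)))
          (dP.fun_mul (differentiableAt_const _)),
        sprayD_add G dGj (dPj.fun_mul (differentiableAt_coord_snd i)),
        sprayD_mul G dPj (differentiableAt_coord_snd i), sprayD_coord_snd]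
      have e : (fun w => P w * (if i = j then (1 : ℝ) else 0))
          = fun w => (if i = j then (1 : ℝ) else 0) * P w := by
        funext w; ring
      rw [e, sprayD_const_mul G dP]
      push_cast
      ring
    · exact ((contDiffOn_dY hΩ (sG i) j).add
        ((contDiffOn_dY hΩ sP j).mul (contDiffOn_coord_snd i))).add (sP.mul contDiffOn_const)
    · intro w hw r hr
      simp only [hGj i j w hw r hr, hPj w hw r hr, h.homog w hw r hr, PiLp.smul_apply, smul_eq_mul]
      ring
  -- Expand the product of the two connection matrices; Euler's relation evaluates `yᵏ ∂Gⁱ/∂yᵏ = 2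
  -- Gⁱ` and `yᵏ ∂P/∂yᵏ = P`.
  have e2 : ∑ k, dY k (G' i) z * dY j (G' k) z
      = ∑ k, dY k (G i) z * dY j (G k) z + 2 * G i z * dY j P z + 2 * P z * dY j (G i) z
        + z.2 i * ∑ k, dY j (G k) z * dY k P z + 3 * P z * dY j P z * z.2 i
        + P z ^ 2 * (if i = j then 1 else 0) := by
    have a1 := (h.homog_spray i).euler hΩ (sG i) hz
    have a2 := h.homog.euler hΩ sP hz
    simp only [h.dY_spray hz]
    have a3 : ∀ k, (dY k (G i) z + dY k P z * z.2 i + P z * (if i = k then 1 else 0))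
        * (dY j (G k) z + dY j P z * z.2 k + P z * (if k = j then 1 else 0))
        = dY k (G i) z * dY j (G k) z + dY j P z * (z.2 k * dY k (G i) z)
          + P z * ((if k = j then 1 else 0) * dY k (G i) z)
          + z.2 i * (dY j (G k) z * dY k P z) + z.2 i * dY j P z * (z.2 k * dY k P z)
          + z.2 i * P z * ((if k = j then 1 else 0) * dY k P z)
          + P z * ((if k = i then 1 else 0)
            * (dY j (G k) z + dY j P z * z.2 k + P z * (if k = j then 1 else 0))) := by
      intro k
      have : (if i = k then (1 : ℝ) else 0) = if k = i then 1 else 0 := by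
        simp only [eq_comm]
      rw [this]
      ring
    simp only [a3, Finset.sum_add_distrib, ← Finset.mul_sum, sum_ite_mul_eq, a1, a2]
    push_cast
    ring
  rw [jacobi, e1, e2, h.dX_spray hz, jacobi, horD, eulerLagrangeForm]
  ring

end IsLocalFactor

end ProjectiveChange

/-! ### Constant flag curvature and the Hamel equation in coordinates -/

section LocalCurvature

variable {n : ℕ} {Ω : Set (Vec n × Vec n)} {G G' : Fin n → Vec n × Vec n → ℝ}
  {f g P L L' : Vec n × Vec n → ℝ} {z : Vec n × Vec n}

/-! ### Leibniz rules for the horizontal derivative and the Euler-Lagrange form -/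

theorem horD_add (hf : DifferentiableAt ℝ f z) (hg : DifferentiableAt ℝ g z) (j : Fin n) :
    horD G j (fun w => f w + g w) z = horD G j f z + horD G j g z := by
  simp only [horD, dX_add hf hg, dY_add hf hg, mul_add, Finset.sum_add_distrib]
  ring

theorem horD_sub (hf : DifferentiableAt ℝ f z) (hg : DifferentiableAt ℝ g z) (j : Fin n) :
    horD G j (fun w => f w - g w) z = horD G j f z - horD G j g z := by
  simp only [horD, dX_sub hf hg, dY_sub hf hg, mul_sub, Finset.sum_sub_distrib]
  ring

theorem horD_mul (hf : DifferentiableAt ℝ f z) (hg : DifferentiableAt ℝ g z) (j : Fin n) :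
    horD G j (fun w => f w * g w) z = horD G j f z * g z + f z * horD G j g z := by
  have h : ∀ k, dY j (G k) z * dY k (fun w => f w * g w) z
      = g z * (dY j (G k) z * dY k f z) + f z * (dY j (G k) z * dY k g z) := by
    intro k
    rw [dY_mul hf hg]
    ring
  simp only [horD, dX_mul hf hg, h, Finset.sum_add_distrib, ← Finset.mul_sum]
  ring

theorem horD_const_mul (hf : DifferentiableAt ℝ f z) (c : ℝ) (j : Fin n) :
    horD G j (fun w => c * f w) z = c * horD G j f z := by
  simp only [horD, dX_const_mul hf, dY_const_mul hf, mul_sub, Finset.mul_sum, mul_left_comm c]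

theorem eulerLagrangeForm_add (hΩ : IsOpen Ω) (hf : ContDiffOn ℝ ∞ f Ω)
    (hg : ContDiffOn ℝ ∞ g Ω) (hz : z ∈ Ω) (j : Fin n) :
    eulerLagrangeForm G (fun w => f w + g w) j z
      = eulerLagrangeForm G f j z + eulerLagrangeForm G g j z := by
  rw [eulerLagrangeForm, sprayD_congr hΩ (g := fun w => dY j f w + dY j g w)
      (fun w hw => dY_add (hf.diffAt hΩ hw) (hg.diffAt hΩ hw) j) hz,
    sprayD_add G ((contDiffOn_dY hΩ hf j).diffAt hΩ hz) ((contDiffOn_dY hΩ hg j).diffAt hΩ hz),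
    dX_add (hf.diffAt hΩ hz) (hg.diffAt hΩ hz), eulerLagrangeForm, eulerLagrangeForm]
  ring

theorem eulerLagrangeForm_sub (hΩ : IsOpen Ω) (hf : ContDiffOn ℝ ∞ f Ω)
    (hg : ContDiffOn ℝ ∞ g Ω) (hz : z ∈ Ω) (j : Fin n) :
    eulerLagrangeForm G (fun w => f w - g w) j z
      = eulerLagrangeForm G f j z - eulerLagrangeForm G g j z := by
  rw [eulerLagrangeForm, sprayD_congr hΩ (g := fun w => dY j f w - dY j g w)
      (fun w hw => dY_sub (hf.diffAt hΩ hw) (hg.diffAt hΩ hw) j) hz,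
    sprayD_sub G ((contDiffOn_dY hΩ hf j).diffAt hΩ hz) ((contDiffOn_dY hΩ hg j).diffAt hΩ hz),
    dX_sub (hf.diffAt hΩ hz) (hg.diffAt hΩ hz), eulerLagrangeForm, eulerLagrangeForm]
  ring

theorem eulerLagrangeForm_mul (hΩ : IsOpen Ω) (hf : ContDiffOn ℝ ∞ f Ω)
    (hg : ContDiffOn ℝ ∞ g Ω) (hz : z ∈ Ω) (j : Fin n) :
    eulerLagrangeForm G (fun w => f w * g w) j z
      = eulerLagrangeForm G f j z * g z + f z * eulerLagrangeForm G g j z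
        + sprayD G f z * dY j g z + sprayD G g z * dY j f z := by
  have df := hf.diffAt hΩ hz
  have dg := hg.diffAt hΩ hz
  have dfj := (contDiffOn_dY hΩ hf j).diffAt hΩ hz
  have dgj := (contDiffOn_dY hΩ hg j).diffAt hΩ hz
  rw [eulerLagrangeForm, sprayD_congr hΩ (g := fun w => dY j f w * g w + f w * dY j g w)
      (fun w hw => dY_mul (hf.diffAt hΩ hw) (hg.diffAt hΩ hw) j) hz,
    sprayD_add G (dfj.fun_mul dg) (df.fun_mul dgj), sprayD_mul G dfj dg, sprayD_mul G df dgj,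
    dX_mul df dg, eulerLagrangeForm, eulerLagrangeForm]
  ring

theorem eulerLagrangeForm_const_mul (hΩ : IsOpen Ω) (hf : ContDiffOn ℝ ∞ f Ω) (c : ℝ)
    (hz : z ∈ Ω) (j : Fin n) :
    eulerLagrangeForm G (fun w => c * f w) j z = c * eulerLagrangeForm G f j z := by
  rw [eulerLagrangeForm, sprayD_congr hΩ (g := fun w => c * dY j f w)
      (fun w hw => dY_const_mul (hf.diffAt hΩ hw) c j) hz,
    sprayD_const_mul G ((contDiffOn_dY hΩ hf j).diffAt hΩ hz),
    dX_const_mul (hf.diffAt hΩ hz), eulerLagrangeForm]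
  ring

theorem dY_sq (hf : DifferentiableAt ℝ f z) (j : Fin n) :
    dY j (fun w => f w ^ 2) z = 2 * f z * dY j f z := by
  simp only [pow_two]
  rw [dY_mul hf hf]
  ring

/-- A multiple of the identity plus a matrix of rank at most one vanishes only trivially. -/
theorem eq_zero_of_smul_one_add_vecMulVec (hn : 2 ≤ n) {y b : Fin n → ℝ} (hy : y ≠ 0) {a : ℝ}
    (h : ∀ i j, a * (if i = j then 1 else 0) + y i * b j = 0) : a = 0 ∧ ∀ j, b j = 0 := by
  obtain ⟨i, hi⟩ := Function.ne_iff.1 hy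
  have : Nontrivial (Fin n) := Fin.nontrivial_iff_two_le.2 hn
  obtain ⟨j, hj⟩ := exists_ne i
  -- With `yᵢ ≠ 0` the off-diagonal entry `(i, j)` forces `bⱼ = 0`; then the diagonal entry `(j, j)`
  -- forces `a = 0`.
  have h1 := h i j
  simp only [hj.symm, if_false, mul_zero, zero_add] at h1
  have h2 : b j = 0 := (mul_eq_zero.1 h1).resolve_left hi
  have ha : a = 0 := by simpa [h2] using h j j
  refine ⟨ha, fun k => ?_⟩
  have h3 := h i k
  rw [ha, zero_mul, zero_add] at h3
  exact (mul_eq_zero.1 h3).resolve_left hi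

/-- The Jacobi endomorphism of `L` is that of constant flag curvature `κ` on `Ω`. -/
def HasFlagCurvatureOn (κ : ℝ) (L : Vec n × Vec n → ℝ) (Ω : Set (Vec n × Vec n)) : Prop :=
  ∀ z ∈ Ω, ∀ i j : Fin n, jacobi (geodesicCoeff L) i j z =
    κ * (L z ^ 2 * (if i = j then 1 else 0) - L z * dY j L z * z.2 i)

/-- The function `κ L² + P² - S(P)`. -/
def ricciFactor (κ : ℝ) (L P : Vec n × Vec n → ℝ) (z : Vec n × Vec n) : ℝ :=
  κ * L z ^ 2 + P z * P z - sprayD (geodesicCoeff L) P z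

theorem contDiffOn_ricciFactor (hL : IsLocalFinsler L Ω)
    (hP : IsLocalFactor (geodesicCoeff L) G' P Ω) (κ : ℝ) : ContDiffOn ℝ ∞ (ricciFactor κ L P) Ω :=
  ((contDiffOn_const.mul hL.smooth_sq).add (hP.smooth.mul hP.smooth)).sub
    (contDiffOn_sprayD hL.isOpen hL.smooth_geodesicCoeff hP.smooth)

theorem homogOn_ricciFactor (hL : IsLocalFinsler L Ω)
    (hP : IsLocalFactor (geodesicCoeff L) G' P Ω) (κ : ℝ) : HomogOn 2 (ricciFactor κ L P) Ω := by
  intro z hz r hr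
  have h1 := hP.homog.along_spray hL.isOpen hL.conic hL.homog_geodesicCoeff hP.smooth z hz r hr
  simp only [ricciFactor, hL.homog z hz r hr, hP.homog z hz r hr, h1]
  ring

theorem dY_ricciFactor (hL : IsLocalFinsler L Ω)
    (hP : IsLocalFactor (geodesicCoeff L) G' P Ω) (κ : ℝ) (hz : z ∈ Ω) (j : Fin n) :
    dY j (ricciFactor κ L P) z = 2 * κ * (L z * dY j L z) + 2 * P z * dY j P z
      - eulerLagrangeForm (geodesicCoeff L) P j z - 2 * horD (geodesicCoeff L) j P z := by
  have hΩ := hL.isOpen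
  have d1 := hL.smooth_sq.diffAt hΩ hz
  have d2 := hP.smooth.diffAt hΩ hz
  have d3 := (contDiffOn_sprayD hΩ hL.smooth_geodesicCoeff hP.smooth).diffAt hΩ hz
  have e : ricciFactor κ L P
      = fun w => (κ * L w ^ 2 + P w * P w) - sprayD (geodesicCoeff L) P w := rfl
  rw [e, dY_sub ((d1.const_mul κ).fun_add (d2.fun_mul d2)) d3,
    dY_add (d1.const_mul κ) (d2.fun_mul d2), dY_const_mul d1, dY_mul d2 d2,
    dY_sq (hL.smooth.diffAt hΩ hz), dY_sprayD_eq hΩ hL.smooth_geodesicCoeff hP.smooth hz]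
  ring

/-- The horizontal derivative of `P` in `IsLocalFactor.jacobi_eq` is traded for the `y`-derivative
of `ricciFactor`, so that the only obstruction to the isotropic shape is a multiple of `δ_S P`. -/
theorem jacobi_eq_ricciFactor (hL : IsLocalFinsler L Ω)
    (hP : IsLocalFactor (geodesicCoeff L) G' P Ω) {κ : ℝ} (hκ : HasFlagCurvatureOn κ L Ω) (hz : z ∈ Ω)
    (i j : Fin n) :
    jacobi G' i j z = ricciFactor κ L P z * (if i = j then 1 else 0)
      - z.2 i * (1 / 2 * dY j (ricciFactor κ L P) z
        + 3 / 2 * eulerLagrangeForm (geodesicCoeff L) P j z) := by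
  rw [hP.jacobi_eq hz, hκ z hz, dY_ricciFactor hL hP κ hz, ricciFactor]
  ring

/-- If both curvatures are constant, then the Hamel equation holds. -/
theorem eulerLagrangeForm_eq_zero_of_flagCurvature (hn : 2 ≤ n) (hne : ∀ z ∈ Ω, z.2 ≠ 0)
    (hL : IsLocalFinsler L Ω) (hL' : IsLocalFinsler L' Ω)
    (hP : IsLocalFactor (geodesicCoeff L) (geodesicCoeff L') P Ω) {κ κ' : ℝ}
    (hκ : HasFlagCurvatureOn κ L Ω) (hκ' : HasFlagCurvatureOn κ' L' Ω) (hz : z ∈ Ω) (j : Fin n) :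
    eulerLagrangeForm (geodesicCoeff L) P j z = 0 := by
  have hΩ := hL.isOpen
  have key : ∀ w ∈ Ω, ricciFactor κ L P w - κ' * L' w ^ 2 = 0 ∧
      ∀ j, κ' * (L' w * dY j L' w) - 1 / 2 * dY j (ricciFactor κ L P) w
        - 3 / 2 * eulerLagrangeForm (geodesicCoeff L) P j w = 0 := by
    intro w hw
    refine eq_zero_of_smul_one_add_vecMulVec hn (y := w.2)
      (fun h0 => hne w hw (PiLp.ext fun i => congrFun h0 i)) fun i j => ?_
    have h1 := jacobi_eq_ricciFactor hL hP hκ hw i j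
    rw [hκ' w hw i j] at h1
    linear_combination -h1
  -- Inserting `ρ = κ' L'²`, valid on all of `Ω`, the term `½ ∂ρ/∂yʲ` equals `κ' L' ∂L'/∂yʲ` and
  -- only the multiple of `δ_S P` remains.
  have h1 := (key z hz).2 j
  rw [dY_congr hΩ (g := fun w => κ' * L' w ^ 2) (fun w hw => sub_eq_zero.1 (key w hw).1) hz,
    dY_const_mul (hL'.smooth_sq.diffAt hΩ hz), dY_sq (hL'.smooth.diffAt hΩ hz)] at h1
  linarith

/-- Contract `R' = ρ Id - ½ y ⊗ ∂ρ/∂y` with the `y`-derivative of `L'²`: the result is zero by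
`sum_jacobi_mul_dY_sq`, and Euler's relation evaluates the rank one part. -/
theorem ricciFactor_mul_dY_sq (hL : IsLocalFinsler L Ω) (hL' : IsLocalFinsler L' Ω)
    (hP : IsLocalFactor (geodesicCoeff L) (geodesicCoeff L') P Ω) {κ : ℝ}
    (hκ : HasFlagCurvatureOn κ L Ω)
    (hE : ∀ z ∈ Ω, ∀ i, eulerLagrangeForm (geodesicCoeff L) P i z = 0) (hz : z ∈ Ω) (j : Fin n) :
    ricciFactor κ L P z * dY j (fun w => L' w ^ 2) z
      = dY j (ricciFactor κ L P) z * L' z ^ 2 := by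
  have h1 := hL'.sum_jacobi_mul_dY_sq hz j
  have h2 := hL'.homog_sq.euler hL'.isOpen hL'.smooth_sq hz
  have h3 : ∀ k, jacobi (geodesicCoeff L') k j z * dY k (fun w => L' w ^ 2) z
      = ricciFactor κ L P z * ((if k = j then 1 else 0) * dY k (fun w => L' w ^ 2) z)
        - 1 / 2 * dY j (ricciFactor κ L P) z * (z.2 k * dY k (fun w => L' w ^ 2) z) := by
    intro k
    rw [jacobi_eq_ricciFactor hL hP hκ hz, hE z hz]
    ring
  simp only [h3, Finset.sum_sub_distrib, ← Finset.mul_sum, sum_ite_mul_eq, h2] at h1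
  push_cast at h1
  linarith

/-- The curvature function `(κ L² + P² - S(P)) / L'²` of the projectively changed metric. -/
def curvatureRatio (κ : ℝ) (L L' P : Vec n × Vec n → ℝ) (z : Vec n × Vec n) : ℝ :=
  ricciFactor κ L P z / L' z ^ 2

theorem contDiffOn_curvatureRatio (hL : IsLocalFinsler L Ω) (hL' : IsLocalFinsler L' Ω)
    (hP : IsLocalFactor (geodesicCoeff L) G' P Ω) (κ : ℝ) :
    ContDiffOn ℝ ∞ (curvatureRatio κ L L' P) Ω :=
  (contDiffOn_ricciFactor hL hP κ).div hL'.smooth_sq fun w hw => (pow_pos (hL'.pos w hw) 2).ne'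

theorem ricciFactor_eq (hL' : IsLocalFinsler L' Ω) (κ : ℝ) (hz : z ∈ Ω) :
    ricciFactor κ L P z = curvatureRatio κ L L' P z * L' z ^ 2 :=
  (div_mul_cancel₀ _ (pow_pos (hL'.pos z hz) 2).ne').symm

/-- `ricciFactor_mul_dY_sq` says that the numerator of the quotient rule for `ρ / L'²` vanishes. -/
theorem dY_curvatureRatio (hL : IsLocalFinsler L Ω) (hL' : IsLocalFinsler L' Ω)
    (hP : IsLocalFactor (geodesicCoeff L) (geodesicCoeff L') P Ω) {κ : ℝ}
    (hκ : HasFlagCurvatureOn κ L Ω)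
    (hE : ∀ z ∈ Ω, ∀ i, eulerLagrangeForm (geodesicCoeff L) P i z = 0) (hz : z ∈ Ω) (j : Fin n) :
    dY j (curvatureRatio κ L L' P) z = 0 := by
  have hΩ := hL.isOpen
  have h1 := ricciFactor_mul_dY_sq hL hL' hP hκ hE hz j
  rw [dY_congr hΩ (fun w hw => ricciFactor_eq hL' κ hw) hz,
    dY_mul ((contDiffOn_curvatureRatio hL hL' hP κ).diffAt hΩ hz) (hL'.smooth_sq.diffAt hΩ hz),
    ricciFactor_eq hL' κ hz] at h1
  have h2 := pow_pos (hL'.pos z hz) 2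
  have h3 : dY j (curvatureRatio κ L L' P) z * (L' z ^ 2 * L' z ^ 2) = 0 := by linarith
  exact (mul_eq_zero.1 h3).resolve_right (by positivity)

/-- Under the Hamel equation, `L'` has isotropic curvature. -/
theorem jacobi_eq_curvatureRatio (hL : IsLocalFinsler L Ω) (hL' : IsLocalFinsler L' Ω)
    (hP : IsLocalFactor (geodesicCoeff L) (geodesicCoeff L') P Ω) {κ : ℝ}
    (hκ : HasFlagCurvatureOn κ L Ω)
    (hE : ∀ z ∈ Ω, ∀ i, eulerLagrangeForm (geodesicCoeff L) P i z = 0) (hz : z ∈ Ω)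
    (i j : Fin n) :
    jacobi (geodesicCoeff L') i j z = curvatureRatio κ L L' P z *
      (L' z ^ 2 * (if i = j then 1 else 0) - L' z * dY j L' z * z.2 i) := by
  have hΩ := hL.isOpen
  rw [jacobi_eq_ricciFactor hL hP hκ hz, hE z hz,
    dY_congr hΩ (fun w hw => ricciFactor_eq hL' κ hw) hz,
    dY_mul ((contDiffOn_curvatureRatio hL hL' hP κ).diffAt hΩ hz) (hL'.smooth_sq.diffAt hΩ hz),
    dY_curvatureRatio hL hL' hP hκ hE hz, dY_sq (hL'.smooth.diffAt hΩ hz),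
    ricciFactor_eq hL' κ hz]
  ring

/-- Projective change of the operator `δ_S - d_h` in degree 2. It allows the identity for `ρ` to be
proved with the spray of `L`, where the curvature is known, and used with that of `L'`. -/
theorem eulerLagrangeForm_sub_horD_eq (hP : IsLocalFactor G G' P Ω) (hf : ContDiffOn ℝ ∞ f Ω)
    (hfh : HomogOn 2 f Ω) (hz : z ∈ Ω) (j : Fin n) :
    eulerLagrangeForm G' f j z - horD G' j f z
      = eulerLagrangeForm G f j z - horD G j f z - P z * dY j f z + 2 * dY j P z * f z := by
  have h1 := hfh.euler hP.isOpen hf hz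
  have h2 : ∀ k, dY j (G' k) z * dY k f z = dY j (G k) z * dY k f z
      + dY j P z * (z.2 k * dY k f z) + P z * ((if k = j then 1 else 0) * dY k f z) := by
    intro k
    rw [hP.dY_spray hz]
    ring
  rw [eulerLagrangeForm, hP.sprayD_eq_of_homogOn hz (contDiffOn_dY hP.isOpen hf j)
    (hfh.partialY hP.isOpen hP.conic hf j), horD]
  simp only [h2, Finset.sum_add_distrib, ← Finset.mul_sum, sum_ite_mul_eq, h1]
  rw [eulerLagrangeForm, horD]
  push_cast
  ring

/-- The curvature identity `δ_S(S P) - d_h(S P) = 2 Rᵏⱼ ∂P/∂yᵏ dxʲ` for Hamel functions. -/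
theorem eulerLagrangeForm_sub_horD_sprayD (hΩ : IsOpen Ω) (hG : ∀ k, ContDiffOn ℝ ∞ (G k) Ω)
    (hP : ContDiffOn ℝ ∞ P Ω) (hE : ∀ z ∈ Ω, ∀ i, eulerLagrangeForm G P i z = 0) (hz : z ∈ Ω)
    (j : Fin n) :
    eulerLagrangeForm G (sprayD G P) j z - horD G j (sprayD G P) z
      = 2 * ∑ k, jacobi G k j z * dY k P z := by
  -- For a Hamel function `∂(S P)/∂yᵏ = 2 δP/δxᵏ`, so the left side becomes twice the commutator
  -- expression of `sum_jacobi_mul_dY`.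
  have h1 : ∀ k, Set.EqOn (dY k (sprayD G P)) (fun w => 2 * horD G k P w) Ω := by
    intro k w hw
    rw [dY_sprayD_eq hΩ hG hP hw, hE w hw, zero_add]
  have h2 : horD G j (sprayD G P) z
      = dX j (sprayD G P) z - 2 * ∑ k, dY j (G k) z * horD G k P z := by
    rw [horD, Finset.mul_sum]
    congr 1
    exact Finset.sum_congr rfl fun k _ => by rw [h1 k hz]; ring
  rw [sum_jacobi_mul_dY hΩ hG hP hz, eulerLagrangeForm, sprayD_congr hΩ (h1 j) hz,
    sprayD_const_mul G ((contDiffOn_horD hΩ hG hP j).diffAt hΩ hz), h2]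
  ring

/-- The substitute for the Bianchi identity in Schur's lemma. The operator kills `L²`; its value on
`S(P)` is given by the constant curvature of `L`, and the remaining terms cancel against the
projective correction. -/
theorem eulerLagrangeForm_sub_horD_ricciFactor (hL : IsLocalFinsler L Ω)
    (hP : IsLocalFactor (geodesicCoeff L) G' P Ω) {κ : ℝ} (hκ : HasFlagCurvatureOn κ L Ω)
    (hE : ∀ z ∈ Ω, ∀ i, eulerLagrangeForm (geodesicCoeff L) P i z = 0) (hz : z ∈ Ω)
    (j : Fin n) :
    eulerLagrangeForm G' (ricciFactor κ L P) j z - horD G' j (ricciFactor κ L P) z = 0 := by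
  have hΩ := hL.isOpen
  have s1 := hL.smooth_sq
  have s2 := hP.smooth
  have s3 := contDiffOn_sprayD hΩ hL.smooth_geodesicCoeff s2
  have d1 := s1.diffAt hΩ hz
  have d2 := s2.diffAt hΩ hz
  have d3 := s3.diffAt hΩ hz
  have e : ricciFactor κ L P
      = fun w => (κ * L w ^ 2 + P w * P w) - sprayD (geodesicCoeff L) P w := rfl
  have h1 := eulerLagrangeForm_sub_horD_sprayD hΩ hL.smooth_geodesicCoeff s2 hE hz j
  have h2 : ∑ k, jacobi (geodesicCoeff L) k j z * dY k P z
      = κ * (L z ^ 2 * dY j P z - L z * dY j L z * P z) := by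
    have h3 : ∀ k, jacobi (geodesicCoeff L) k j z * dY k P z
        = κ * L z ^ 2 * ((if k = j then 1 else 0) * dY k P z)
          - κ * L z * dY j L z * (z.2 k * dY k P z) := by
      intro k
      rw [hκ z hz]
      ring
    simp only [h3, Finset.sum_sub_distrib, ← Finset.mul_sum, sum_ite_mul_eq,
      hP.homog.euler hΩ s2 hz]
    push_cast
    ring
  rw [eulerLagrangeForm_sub_horD_eq hP (contDiffOn_ricciFactor hL hP κ)
    (homogOn_ricciFactor hL hP κ) hz, dY_ricciFactor hL hP κ hz, hE z hz]
  rw [e, eulerLagrangeForm_sub hΩ ((contDiffOn_const.mul s1).add (s2.mul s2)) s3 hz,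
    eulerLagrangeForm_add hΩ (contDiffOn_const.mul s1) (s2.mul s2) hz,
    eulerLagrangeForm_const_mul hΩ s1 κ hz, eulerLagrangeForm_mul hΩ s2 s2 hz,
    horD_sub ((d1.const_mul κ).fun_add (d2.fun_mul d2)) d3,
    horD_add (d1.const_mul κ) (d2.fun_mul d2), horD_const_mul d1, horD_mul d2 d2, hL.horD_sq hz,
    eulerLagrangeForm_geodesicCoeff L z (hL.posDef z hz), hE z hz]
  linear_combination -h1 - 2 * h2

/-- Put `ρ = K L'²` in the previous identity. As `K` is independent of `y` and `L'²` is annihilated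
by `S'`, `d_{h'}` and `δ_{S'}`, only first derivatives of `K` survive. -/
theorem sprayD_curvatureRatio (hL : IsLocalFinsler L Ω) (hL' : IsLocalFinsler L' Ω)
    (hP : IsLocalFactor (geodesicCoeff L) (geodesicCoeff L') P Ω) {κ : ℝ}
    (hκ : HasFlagCurvatureOn κ L Ω)
    (hE : ∀ z ∈ Ω, ∀ i, eulerLagrangeForm (geodesicCoeff L) P i z = 0) (hz : z ∈ Ω) (j : Fin n) :
    sprayD (geodesicCoeff L') (curvatureRatio κ L L' P) z * dY j (fun w => L' w ^ 2) z
      = 2 * dX j (curvatureRatio κ L L' P) z * L' z ^ 2 := by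
  have hΩ := hL.isOpen
  have sK := contDiffOn_curvatureRatio hL hL' hP κ
  have e : Set.EqOn (ricciFactor κ L P) (fun w => curvatureRatio κ L L' P w * L' w ^ 2) Ω :=
    fun w hw => ricciFactor_eq hL' κ hw
  have h1 := eulerLagrangeForm_sub_horD_ricciFactor hL hP hκ hE hz j
  have h2 : eulerLagrangeForm (geodesicCoeff L') (ricciFactor κ L P) j z
      = eulerLagrangeForm (geodesicCoeff L') (fun w => curvatureRatio κ L L' P w * L' w ^ 2) j z := by
    rw [eulerLagrangeForm, sprayD_congr hΩ (fun w hw => dY_congr hΩ e hw j) hz,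
      dX_congr hΩ e hz, eulerLagrangeForm]
  have h3 : horD (geodesicCoeff L') j (ricciFactor κ L P) z
      = horD (geodesicCoeff L') j (fun w => curvatureRatio κ L L' P w * L' w ^ 2) z := by
    simp only [horD, dX_congr hΩ e hz, dY_congr hΩ e hz]
  have h4 := fun k => dY_curvatureRatio hL hL' hP hκ hE hz k
  have h5 : eulerLagrangeForm (geodesicCoeff L') (curvatureRatio κ L L' P) j z
      = - dX j (curvatureRatio κ L L' P) z := by
    rw [eulerLagrangeForm, sprayD_congr hΩ (g := fun _ => 0)
      (fun w hw => dY_curvatureRatio hL hL' hP hκ hE hw j) hz, sprayD_eq_fderiv]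
    simp
  have h6 : horD (geodesicCoeff L') j (curvatureRatio κ L L' P) z
      = dX j (curvatureRatio κ L L' P) z := by
    simp [horD, h4]
  rw [h2, h3, eulerLagrangeForm_mul hΩ sK hL'.smooth_sq hz,
    horD_mul (sK.diffAt hΩ hz) (hL'.smooth_sq.diffAt hΩ hz), h4, h5, h6, hL'.sprayD_sq hz,
    hL'.horD_sq hz, eulerLagrangeForm_geodesicCoeff L' z (hL'.posDef z hz)] at h1
  linear_combination h1

end LocalCurvature

/-! ### Constancy of the curvature function -/

section Constancy

variable {n : ℕ} {U : Set (Vec n)} {f L L' P : Vec n × Vec n → ℝ} {z : Vec n × Vec n}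

theorem isPreconnected_compl_zero (hn : 2 ≤ n) : IsPreconnected ({0}ᶜ : Set (Vec n)) := by
  refine (isConnected_compl_singleton_of_one_lt_rank ?_ 0).isPreconnected
  rw [← Module.finrank_eq_rank, finrank_euclideanSpace, Fintype.card_fin]
  exact_mod_cast hn

theorem isOpen_prod_compl_zero (hU : IsOpen U) : IsOpen (U ×ˢ ({0}ᶜ : Set (Vec n))) :=
  hU.prod isOpen_compl_singleton

theorem isConic_prod_compl_zero (U : Set (Vec n)) : IsConic (U ×ˢ ({0}ᶜ : Set (Vec n))) :=
  fun _ hz _ hr => ⟨hz.1, smul_ne_zero hr.ne' hz.2⟩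

theorem exists_ne_zero_sum_mul_eq_zero (hn : 2 ≤ n) (a : Fin n → ℝ) :
    ∃ y : Vec n, y ≠ 0 ∧ ∑ k, y k * a k = 0 := by
  let φ : Vec n →ₗ[ℝ] ℝ := ∑ k, a k • (EuclideanSpace.proj k : Vec n →L[ℝ] ℝ).toLinearMap
  have h : LinearMap.ker φ ≠ ⊥ := by
    refine LinearMap.ker_ne_bot_of_finrank_lt ?_
    rw [finrank_euclideanSpace, Fintype.card_fin, Module.finrank_self]
    omega
  obtain ⟨y, hy, hy0⟩ := Submodule.exists_mem_ne_zero_of_ne_bot h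
  refine ⟨y, hy0, ?_⟩
  have h1 : φ y = 0 := hy
  simpa [φ, mul_comm] using h1

/-- The `y`-derivatives of `∂f/∂xʲ` vanish by symmetry of second derivatives, and the punctured
fibre is connected for `n ≥ 2`. -/
theorem dX_eq_of_dY_eq_zero (hn : 2 ≤ n) (hU : IsOpen U)
    (hf : ContDiffOn ℝ ∞ f (U ×ˢ {0}ᶜ)) (h : ∀ z ∈ U ×ˢ ({0}ᶜ : Set (Vec n)), ∀ k, dY k f z = 0)
    {x : Vec n} (hx : x ∈ U) {y y' : Vec n} (hy : y ≠ 0) (hy' : y' ≠ 0) (j : Fin n) :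
    dX j f (x, y) = dX j f (x, y') := by
  have hΩ := isOpen_prod_compl_zero hU
  have key : ∀ v ∈ ({0}ᶜ : Set (Vec n)),
      HasFDerivAt (fun v => dX j f (x, v)) (0 : Vec n →L[ℝ] ℝ) v := by
    intro v hv
    have hz : (x, v) ∈ U ×ˢ ({0}ᶜ : Set (Vec n)) := ⟨hx, hv⟩
    have h1 : HasFDerivAt (dX j f ∘ fun v => (x, v))
        ((fderiv ℝ (dX j f) (x, v)).comp (ContinuousLinearMap.inr ℝ (Vec n) (Vec n))) v :=
      HasFDerivAt.comp v ((contDiffOn_dX hΩ hf j).diffAt hΩ hz).hasFDerivAt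
        (hasFDerivAt_prodMk_right x v)
    have h2 : (fderiv ℝ (dX j f) (x, v)).comp (ContinuousLinearMap.inr ℝ (Vec n) (Vec n)) = 0 := by
      refine ContinuousLinearMap.ext fun w => ?_
      change fderiv ℝ (dX j f) (x, v) (0, w) = 0
      rw [fderiv_eq_sum]
      simp only [dY_dX_comm hΩ hf hz, PiLp.zero_apply, zero_mul, Finset.sum_const_zero, zero_add]
      refine Finset.sum_eq_zero fun k _ => ?_
      rw [dX_congr hΩ (g := fun _ => 0) (fun w hw => h w hw k) hz]
      simp [dX]
    rw [h2] at h1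
    exact h1
  exact (isOpen_compl_singleton (x := (0 : Vec n))).is_const_of_fderiv_eq_zero
    (isPreconnected_compl_zero hn)
    (fun v hv => (key v hv).differentiableAt.differentiableWithinAt)
    (fun v hv => (key v hv).fderiv) hy hy'

theorem dX_curvatureRatio (hn : 2 ≤ n) (hU : IsOpen U) (hL : IsLocalFinsler L (U ×ˢ {0}ᶜ))
    (hL' : IsLocalFinsler L' (U ×ˢ {0}ᶜ))
    (hP : IsLocalFactor (geodesicCoeff L) (geodesicCoeff L') P (U ×ˢ {0}ᶜ)) {κ : ℝ}
    (hκ : HasFlagCurvatureOn κ L (U ×ˢ {0}ᶜ))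
    (hE : ∀ z ∈ U ×ˢ ({0}ᶜ : Set (Vec n)), ∀ i, eulerLagrangeForm (geodesicCoeff L) P i z = 0)
    (hz : z ∈ U ×ˢ ({0}ᶜ : Set (Vec n))) (j : Fin n) :
    dX j (curvatureRatio κ L L' P) z = 0 := by
  have hK := contDiffOn_curvatureRatio hL hL' hP κ
  have hY : ∀ w ∈ U ×ˢ ({0}ᶜ : Set (Vec n)), ∀ k, dY k (curvatureRatio κ L L' P) w = 0 :=
    fun w hw k => dY_curvatureRatio hL hL' hP hκ hE hw k
  -- Since `dK` does not depend on the fibre point, `y` may be moved into its kernel. There `S'(K) =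
  -- yᵏ ∂K/∂xᵏ = 0`, while the factor `L'²` stays positive.
  obtain ⟨y, hy, hy0⟩ := exists_ne_zero_sum_mul_eq_zero hn
    fun k => dX k (curvatureRatio κ L L' P) z
  have hw : (z.1, y) ∈ U ×ˢ ({0}ᶜ : Set (Vec n)) := ⟨hz.1, hy⟩
  have e : ∀ k, dX k (curvatureRatio κ L L' P) (z.1, y) = dX k (curvatureRatio κ L L' P) z :=
    fun k => dX_eq_of_dY_eq_zero hn hU hK hY hz.1 hy hz.2 k
  have h1 := sprayD_curvatureRatio hL hL' hP hκ hE hw j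
  have h2 : sprayD (geodesicCoeff L') (curvatureRatio κ L L' P) (z.1, y) = 0 := by
    simp [sprayD, hY _ hw, e, hy0]
  rw [h2, zero_mul, e] at h1
  have h3 := pow_pos (hL'.pos _ hw) 2
  have h4 : dX j (curvatureRatio κ L L' P) z * (2 * L' (z.1, y) ^ 2) = 0 := by linarith
  exact (mul_eq_zero.1 h4).resolve_right (by positivity)

/-- Under the Hamel equation the curvature function is locally constant. -/
theorem curvatureRatio_eq_of_mem_ball (hn : 2 ≤ n) (hU : IsOpen U)
    (hL : IsLocalFinsler L (U ×ˢ {0}ᶜ)) (hL' : IsLocalFinsler L' (U ×ˢ {0}ᶜ))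
    (hP : IsLocalFactor (geodesicCoeff L) (geodesicCoeff L') P (U ×ˢ {0}ᶜ)) {κ : ℝ}
    (hκ : HasFlagCurvatureOn κ L (U ×ˢ {0}ᶜ))
    (hE : ∀ z ∈ U ×ˢ ({0}ᶜ : Set (Vec n)), ∀ i, eulerLagrangeForm (geodesicCoeff L) P i z = 0)
    {x : Vec n} {r : ℝ} (hr : Metric.ball x r ⊆ U) {z w : Vec n × Vec n}
    (hz : z ∈ Metric.ball x r ×ˢ ({0}ᶜ : Set (Vec n)))
    (hw : w ∈ Metric.ball x r ×ˢ ({0}ᶜ : Set (Vec n))) :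
    curvatureRatio κ L L' P z = curvatureRatio κ L L' P w := by
  have hK := contDiffOn_curvatureRatio hL hL' hP κ
  have hsub : Metric.ball x r ×ˢ ({0}ᶜ : Set (Vec n)) ⊆ U ×ˢ {0}ᶜ :=
    Set.prod_mono hr subset_rfl
  refine (isOpen_prod_compl_zero Metric.isOpen_ball).is_const_of_fderiv_eq_zero (𝕜 := ℝ)
    (((convex_ball x r).isPreconnected).prod (isPreconnected_compl_zero hn))
    ((hK.mono hsub).differentiableOn (by simp)) (fun v hv => ?_) hz hw
  refine ContinuousLinearMap.ext fun u => ?_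
  rw [← Prod.mk.eta (p := u), fderiv_eq_sum]
  simp [dX_curvatureRatio hn hU hL hL' hP hκ hE (hsub hv),
    dY_curvatureRatio hL hL' hP hκ hE (hsub hv)]

end Constancy

/-! ### Induced coordinates on the tangent bundle -/

section InducedCoordinates

variable {n : ℕ} {M : Type*} [TopologicalSpace M]
  {e e' : OpenPartialHomeomorph M (Vec n)}

/-- The domain of the coordinates induced by `e` on `T₀M`. -/
def coordDomain (e : OpenPartialHomeomorph M (Vec n)) : Set (Vec n × Vec n) :=
  e.target ×ˢ {0}ᶜ

theorem isOpen_coordDomain (e : OpenPartialHomeomorph M (Vec n)) : IsOpen (coordDomain e) :=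
  e.open_target.prod isOpen_compl_singleton

theorem isOpen_overlap (e e' : OpenPartialHomeomorph M (Vec n)) :
    IsOpen (e.target ∩ e.symm ⁻¹' e'.source) :=
  e.isOpen_inter_preimage_symm e'.open_source

variable [ChartedSpace (Vec n) M]

/-- The tangent vector with coordinates `z = (x, y)` in the chart `e`. -/
def coordMap (e : OpenPartialHomeomorph M (Vec n)) (z : Vec n × Vec n) :
    TangentBundle (𝓡 n) M :=
  ⟨e.symm z.1, mfderiv (𝓡 n) (𝓡 n) e.symm z.1 z.2⟩

/-- The coordinates of a tangent vector in the chart `e`. -/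
def coordInv (e : OpenPartialHomeomorph M (Vec n)) (v : TangentBundle (𝓡 n) M) :
    Vec n × Vec n :=
  (e v.1, mfderiv (𝓡 n) (𝓡 n) e v.1 v.2)

theorem inCoords_eq (e : OpenPartialHomeomorph M (Vec n)) (f : TangentBundle (𝓡 n) M → ℝ)
    (z : Vec n × Vec n) : inCoords e f z = f (coordMap e z) := rfl

theorem mdifferentiable_of_mem_maximalAtlas (he : e ∈ IsManifold.maximalAtlas (𝓡 n) ∞ M) :
    e.MDifferentiable (𝓡 n) (𝓡 n) :=
  ⟨(contMDiffOn_of_mem_maximalAtlas he).mdifferentiableOn (by simp),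
    (contMDiffOn_symm_of_mem_maximalAtlas he).mdifferentiableOn (by simp)⟩

theorem contDiffOn_transition (he : e ∈ IsManifold.maximalAtlas (𝓡 n) ∞ M)
    (he' : e' ∈ IsManifold.maximalAtlas (𝓡 n) ∞ M) :
    ContDiffOn ℝ ∞ (e' ∘ e.symm) (e.target ∩ e.symm ⁻¹' e'.source) :=
  ((contMDiffOn_of_mem_maximalAtlas he').comp
    ((contMDiffOn_symm_of_mem_maximalAtlas he).mono Set.inter_subset_left)
    fun _ hx => hx.2).contDiffOn

theorem coordInv_coordMap (he : e ∈ IsManifold.maximalAtlas (𝓡 n) ∞ M) {z : Vec n × Vec n}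
    (hz : z.1 ∈ e.target) : coordInv e (coordMap e z) = z := by
  have h := (mdifferentiable_of_mem_maximalAtlas he).comp_symm_deriv hz
  refine Prod.ext (e.right_inv hz) ?_
  exact congrArg (fun A : Vec n →L[ℝ] Vec n => A z.2) h

theorem coordMap_coordInv (he : e ∈ IsManifold.maximalAtlas (𝓡 n) ∞ M)
    {v : TangentBundle (𝓡 n) M} (hv : v.1 ∈ e.source) : coordMap e (coordInv e v) = v := by
  have h := (mdifferentiable_of_mem_maximalAtlas he).symm_comp_deriv hv
  have h2 := congrArg (fun A : Vec n →L[ℝ] Vec n => A v.2) h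
  refine Bundle.TotalSpace.ext (e.left_inv hv) (heq_of_eq ?_)
  exact h2

theorem coordMap_mem_slit (he : e ∈ IsManifold.maximalAtlas (𝓡 n) ∞ M) {z : Vec n × Vec n}
    (hz : z ∈ coordDomain e) : coordMap e z ∈ slitTangent (n := n) M := by
  intro h0
  have h1 := coordInv_coordMap he hz.1
  have h2 : (coordInv e (coordMap e z)).2 = 0 := by
    change mfderiv (𝓡 n) (𝓡 n) e (coordMap e z).1 (coordMap e z).2 = 0
    rw [h0]
    exact map_zero (mfderiv (𝓡 n) (𝓡 n) e (coordMap e z).1)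
  rw [h1] at h2
  exact hz.2 h2

theorem coordInv_mem_coordDomain (he : e ∈ IsManifold.maximalAtlas (𝓡 n) ∞ M)
    {v : TangentBundle (𝓡 n) M} (hv : v ∈ slitTangent (n := n) M) (hs : v.1 ∈ e.source) :
    coordInv e v ∈ coordDomain e := by
  refine ⟨e.map_source hs, fun h0 => hv ?_⟩
  exact (mdifferentiable_of_mem_maximalAtlas he).mfderiv_injective hs
    (h0.trans (map_zero (mfderiv (𝓡 n) (𝓡 n) e v.1)).symm)

/-- The change of induced coordinates from the chart `e` to the chart `e'`. -/
def coordChange (e e' : OpenPartialHomeomorph M (Vec n)) (z : Vec n × Vec n) : Vec n × Vec n :=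
  ((e' ∘ e.symm) z.1, fderiv ℝ (e' ∘ e.symm) z.1 z.2)

theorem coordInv_coordMap_eq (he : e ∈ IsManifold.maximalAtlas (𝓡 n) ∞ M)
    (he' : e' ∈ IsManifold.maximalAtlas (𝓡 n) ∞ M) {z : Vec n × Vec n}
    (hz : z.1 ∈ e.target) (hz' : e.symm z.1 ∈ e'.source) :
    coordInv e' (coordMap e z) = coordChange e e' z := by
  refine Prod.ext rfl ?_
  have h := mfderiv_comp z.1
    ((mdifferentiable_of_mem_maximalAtlas he').mdifferentiableAt hz')
    ((mdifferentiable_of_mem_maximalAtlas he).mdifferentiableAt_symm hz)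
  rw [mfderiv_eq_fderiv] at h
  exact (congrArg (fun A : Vec n →L[ℝ] Vec n => A z.2) h).symm

theorem coordMap_coordChange (he : e ∈ IsManifold.maximalAtlas (𝓡 n) ∞ M)
    (he' : e' ∈ IsManifold.maximalAtlas (𝓡 n) ∞ M) {z : Vec n × Vec n}
    (hz : z.1 ∈ e.target) (hz' : e.symm z.1 ∈ e'.source) :
    coordMap e' (coordChange e e' z) = coordMap e z := by
  rw [← coordInv_coordMap_eq he he' hz hz', coordMap_coordInv he' hz']

theorem inCoords_coordChange (he : e ∈ IsManifold.maximalAtlas (𝓡 n) ∞ M)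
    (he' : e' ∈ IsManifold.maximalAtlas (𝓡 n) ∞ M) {z : Vec n × Vec n}
    (hz : z.1 ∈ e.target) (hz' : e.symm z.1 ∈ e'.source) (f : TangentBundle (𝓡 n) M → ℝ) :
    inCoords e' f (coordChange e e' z) = inCoords e f z := by
  rw [inCoords_eq, inCoords_eq, coordMap_coordChange he he' hz hz']

theorem coordChange_mem (he : e ∈ IsManifold.maximalAtlas (𝓡 n) ∞ M)
    (he' : e' ∈ IsManifold.maximalAtlas (𝓡 n) ∞ M) {z : Vec n × Vec n}
    (hz : z ∈ coordDomain e) (hz' : e.symm z.1 ∈ e'.source) :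
    coordChange e e' z ∈ coordDomain e' := by
  rw [← coordInv_coordMap_eq he he' hz.1 hz']
  exact coordInv_mem_coordDomain he' (coordMap_mem_slit he hz) hz'

/-- Used to pull a spray back along a change of charts. -/
theorem fderiv_transition_surjective (he : e ∈ IsManifold.maximalAtlas (𝓡 n) ∞ M)
    (he' : e' ∈ IsManifold.maximalAtlas (𝓡 n) ∞ M) {x : Vec n}
    (hx : x ∈ e.target) (hx' : e.symm x ∈ e'.source) :
    Function.Surjective (fderiv ℝ (e' ∘ e.symm) x) := by
  intro v
  obtain ⟨w, hw⟩ := (mdifferentiable_of_mem_maximalAtlas he').mfderiv_surjective hx' v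
  obtain ⟨u, hu⟩ := (mdifferentiable_of_mem_maximalAtlas he).symm.mfderiv_surjective hx w
  refine ⟨u, ?_⟩
  have h := congrArg Prod.snd (coordInv_coordMap_eq he he' (z := (x, u)) hx hx')
  refine h.symm.trans ?_
  refine Eq.trans ?_ hw
  exact congrArg (mfderiv (𝓡 n) (𝓡 n) e' (e.symm x)) hu

variable [IsManifold (𝓡 n) ∞ M]

theorem contMDiff_vectorToTangentModel :
    ContMDiff 𝓘(ℝ, Vec n × Vec n) (𝓡 n).tangent ∞
      (fun z : Vec n × Vec n => (⟨z.1, z.2⟩ : TangentBundle (𝓡 n) (Vec n))) := by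
  intro z
  refine Bundle.contMDiffAt_totalSpace.2 ⟨contDiff_fst.contMDiff.contMDiffAt, ?_⟩
  simp only [trivializationAt_model_space_apply]
  exact contDiff_snd.contMDiff.contMDiffAt

theorem contMDiffOn_coordMap (he : e ∈ IsManifold.maximalAtlas (𝓡 n) ∞ M) :
    ContMDiffOn 𝓘(ℝ, Vec n × Vec n) (𝓡 n).tangent ∞ (coordMap e) (coordDomain e) := by
  have h1 := (contMDiffOn_symm_of_mem_maximalAtlas he).contMDiffOn_tangentMapWithin
    (m := ∞) (by simp) e.open_target.uniqueMDiffOn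
  have h2 := h1.comp (s := coordDomain e) (contMDiff_vectorToTangentModel (n := n)).contMDiffOn
    (fun z hz => hz.1)
  refine h2.congr fun z hz => ?_
  have h3 := (mdifferentiable_of_mem_maximalAtlas he).mdifferentiableAt_symm hz.1
  exact (tangentMapWithin_eq_tangentMap (p := (⟨z.1, z.2⟩ : TangentBundle (𝓡 n) (Vec n)))
    (e.open_target.uniqueMDiffOn _ hz.1) h3).symm

theorem contMDiffOn_coordInv (he : e ∈ IsManifold.maximalAtlas (𝓡 n) ∞ M) :
    ContMDiffOn (𝓡 n).tangent 𝓘(ℝ, Vec n × Vec n) ∞ (coordInv e)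
      (Bundle.TotalSpace.proj ⁻¹' e.source) := by
  have h1 := (contMDiffOn_of_mem_maximalAtlas he).contMDiffOn_tangentMapWithin
    (m := ∞) (by simp) e.open_source.uniqueMDiffOn
  have h2 := (contMDiff_snd_tangentBundle_modelSpace (n := ∞) (Vec n) (𝓡 n)).comp_contMDiffOn h1
  have h3 := (contMDiffOn_of_mem_maximalAtlas he).comp
    (Bundle.contMDiff_proj (F := Vec n) (B := M) (IB := 𝓡 n) (n := ∞)
      (TangentSpace (𝓡 n))).contMDiffOn
    (s := Bundle.TotalSpace.proj ⁻¹' e.source) (fun v hv => hv)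
  refine (h3.prodMk_space h2).congr fun v hv => ?_
  have h4 := (mdifferentiable_of_mem_maximalAtlas he).mdifferentiableAt hv
  exact congrArg (fun A : Vec n →L[ℝ] Vec n => (e v.1, A v.2))
    (mfderivWithin_eq_mfderiv (e.open_source.uniqueMDiffOn _ hv) h4).symm

theorem contDiffOn_inCoords (he : e ∈ IsManifold.maximalAtlas (𝓡 n) ∞ M)
    {f : TangentBundle (𝓡 n) M → ℝ}
    (hf : ContMDiffOn (𝓡 n).tangent 𝓘(ℝ, ℝ) ∞ f (slitTangent (n := n) M)) :
    ContDiffOn ℝ ∞ (inCoords e f) (coordDomain e) :=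
  (hf.comp (contMDiffOn_coordMap he) fun _ hz => coordMap_mem_slit he hz).contDiffOn

theorem homogOn_inCoords (he : e ∈ IsManifold.maximalAtlas (𝓡 n) ∞ M)
    {f : TangentBundle (𝓡 n) M → ℝ} (hf : PosHomogeneous f) :
    HomogOn 1 (inCoords e f) (coordDomain e) := by
  intro z hz r hr
  have h := hf (e.symm z.1) (mfderiv (𝓡 n) (𝓡 n) e.symm z.1 z.2) r (coordMap_mem_slit he hz) hr
  rw [pow_one]
  refine Eq.trans ?_ h
  exact congrArg (fun v : Vec n => f ⟨e.symm z.1, v⟩)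
    (map_smul (mfderiv (𝓡 n) (𝓡 n) e.symm z.1) r z.2)

theorem IsFinslerMetric.isLocalFinsler {F : TangentBundle (𝓡 n) M → ℝ} (hF : IsFinslerMetric F)
    (he : e ∈ IsManifold.maximalAtlas (𝓡 n) ∞ M) :
    IsLocalFinsler (inCoords e F) (coordDomain e) where
  isOpen := isOpen_coordDomain e
  conic := isConic_prod_compl_zero _
  smooth := contDiffOn_inCoords he hF.smooth
  pos _ hz := hF.pos _ (coordMap_mem_slit he hz)
  homog := homogOn_inCoords he hF.homogeneous
  posDef z hz := hF.posDef e he z hz.1 hz.2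

end InducedCoordinates

/-! ### Invariance of the geodesic spray under changes of coordinates -/

section SprayChange

variable {n : ℕ}

theorem clm_ext_single {E : Type*} [NormedAddCommGroup E] [NormedSpace ℝ E]
    {A B : Vec n →L[ℝ] E}
    (h : ∀ k, A (EuclideanSpace.single k 1) = B (EuclideanSpace.single k 1)) : A = B := by
  have h1 : A.toLinearMap = B.toLinearMap :=
    (EuclideanSpace.basisFun (Fin n) ℝ).toBasis.ext fun k => by simpa using h k
  exact ContinuousLinearMap.ext fun v => congrArg (fun T : Vec n →ₗ[ℝ] E => T v) h1

/-- The derivative of the map `(x, y) ↦ (τ x, dτ(x) y)`. -/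
theorem hasFDerivAt_tangentLift {τ : Vec n → Vec n} {z : Vec n × Vec n}
    (hτ : ContDiffAt ℝ ∞ τ z.1) :
    HasFDerivAt (fun w : Vec n × Vec n => (τ w.1, fderiv ℝ τ w.1 w.2))
      (((fderiv ℝ τ z.1).comp (.fst ℝ (Vec n) (Vec n))).prod
        ((fderiv ℝ τ z.1).comp (.snd ℝ (Vec n) (Vec n))
          + ((fderiv ℝ (fderiv ℝ τ) z.1).comp (.fst ℝ (Vec n) (Vec n))).flip z.2)) z := by
  have h1 : HasFDerivAt τ (fderiv ℝ τ z.1) z.1 :=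
    (hτ.differentiableAt (by simp)).hasFDerivAt
  have h2 : HasFDerivAt (fderiv ℝ τ) (fderiv ℝ (fderiv ℝ τ) z.1) z.1 :=
    ((hτ.fderiv_right (m := ∞) (by simp)).differentiableAt (by simp)).hasFDerivAt
  exact (h1.comp z hasFDerivAt_fst).prodMk ((h2.comp z hasFDerivAt_fst).clm_apply hasFDerivAt_snd)

theorem fderiv_tangentLift_apply {τ : Vec n → Vec n} {z : Vec n × Vec n}
    (hτ : ContDiffAt ℝ ∞ τ z.1) (u v : Vec n) :
    fderiv ℝ (fun w : Vec n × Vec n => (τ w.1, fderiv ℝ τ w.1 w.2)) z (u, v)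
      = (fderiv ℝ τ z.1 u, fderiv ℝ τ z.1 v + fderiv ℝ (fderiv ℝ τ) z.1 u z.2) := by
  rw [(hasFDerivAt_tangentLift hτ).fderiv]
  simp

/-- The target spray is pulled back to a vector `(y, -2 g)` at `z`, and `g` is shown to solve the
Euler-Lagrange equation of `L`. Positive definiteness makes the solution unique, so no explicit
transformation law for `geodesicCoeff` is needed. -/
theorem fderiv_tangentLift_sprayVec {τ : Vec n → Vec n} {V : Set (Vec n)} (hV : IsOpen V)
    (hτ : ContDiffOn ℝ ∞ τ V) {Ω Ω' : Set (Vec n × Vec n)} {L L' : Vec n × Vec n → ℝ}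
    (hL : IsLocalFinsler L Ω) (hL' : IsLocalFinsler L' Ω') {z : Vec n × Vec n} (hz : z ∈ Ω)
    (hzV : z.1 ∈ V) (hsurj : Function.Surjective (fderiv ℝ τ z.1))
    (hmaps : ∀ w ∈ Ω, w.1 ∈ V → (τ w.1, fderiv ℝ τ w.1 w.2) ∈ Ω')
    (heq : ∀ w ∈ Ω, w.1 ∈ V → L w = L' (τ w.1, fderiv ℝ τ w.1 w.2)) :
    fderiv ℝ (fun w : Vec n × Vec n => (τ w.1, fderiv ℝ τ w.1 w.2)) z
        (sprayVec (geodesicCoeff L) z)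
      = sprayVec (geodesicCoeff L') (τ z.1, fderiv ℝ τ z.1 z.2) := by
  set Φ : Vec n × Vec n → Vec n × Vec n := fun w => (τ w.1, fderiv ℝ τ w.1 w.2) with hΦ
  set h : Vec n × Vec n → ℝ := fun w => L' w ^ 2 with hh
  set D := fderiv ℝ τ z.1 with hD
  set D2 := fderiv ℝ (fderiv ℝ τ) z.1 with hD2
  have hτz : ContDiffAt ℝ ∞ τ z.1 := hτ.contDiffAt (hV.mem_nhds hzV)
  have hΦz : Φ z ∈ Ω' := hmaps z hz hzV
  have hΩ0 : IsOpen (Ω ∩ Prod.fst ⁻¹' V) := hL.isOpen.inter (hV.preimage continuous_fst)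
  have hz0 : z ∈ Ω ∩ Prod.fst ⁻¹' V := ⟨hz, hzV⟩
  -- The second component of the lifted vector is `-2 Dτ(g) + D²τ(y, y)`; this choice of `g` makes
  -- it `-2 G'`.
  obtain ⟨g, hg⟩ := hsurj ((WithLp.toLp 2 fun k => geodesicCoeff L' k (Φ z))
    + (1 / 2 : ℝ) • D2 z.2 z.2)
  have hsym : ∀ u v, D2 u v = D2 v u := fun u v =>
    (hτz.isSymmSndFDerivAt (by simpa using WithTop.coe_le_coe.2 (le_top (a := (2 : ℕ∞))))) u v
  have hV' : fderiv ℝ Φ z (z.2, (-2 : ℝ) • g) = sprayVec (geodesicCoeff L') (Φ z) := by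
    rw [fderiv_tangentLift_apply hτz, map_smul, ← hD, ← hD2, hg, sprayVec]
    refine Prod.ext rfl ?_
    simp only [smul_add, smul_smul]
    norm_num
  have hhs : ContDiffOn ℝ ∞ h Ω' := hL'.smooth_sq
  have hfd : DifferentiableAt ℝ (fderiv ℝ h) (Φ z) :=
    (((hhs.contDiffAt (hL'.isOpen.mem_nhds hΦz)).fderiv_right (m := ∞)
      (by simp)).differentiableAt (by simp))
  -- The Euler-Lagrange equation of `L'²` without a basis, so that it can be tested on the vectors
  -- `Dτ(eⱼ)`.
  have hEL : (fderiv ℝ (fderiv ℝ h) (Φ z) (sprayVec (geodesicCoeff L') (Φ z))).comp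
        (.inr ℝ (Vec n) (Vec n))
      = (fderiv ℝ h (Φ z)).comp (.inl ℝ (Vec n) (Vec n)) := by
    refine clm_ext_single fun k => ?_
    have h1 := eulerLagrangeForm_geodesicCoeff L' (Φ z) (hL'.posDef _ hΦz) k
    rw [eulerLagrangeForm, sprayD_eq_fderiv, sub_eq_zero] at h1
    have h2 : fderiv ℝ (dY k h) (Φ z) (sprayVec (geodesicCoeff L') (Φ z))
        = fderiv ℝ (fderiv ℝ h) (Φ z) (sprayVec (geodesicCoeff L') (Φ z))
          (0, EuclideanSpace.single k 1) := by
      have h3 : dY k h = fun w => fderiv ℝ h w (0, EuclideanSpace.single k 1) := rfl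
      rw [h3, fderiv_clm_apply hfd (differentiableAt_const _)]
      simp
    exact h2.symm.trans h1
  have hfeq : ∀ w ∈ Ω ∩ Prod.fst ⁻¹' V, ∀ u v : Vec n,
      fderiv ℝ (fun w => L w ^ 2) w (u, v) = fderiv ℝ h (Φ w) (fderiv ℝ Φ w (u, v)) := by
    intro w hw u v
    have h1 : fderiv ℝ (fun w => L w ^ 2) w = fderiv ℝ (h ∘ Φ) w := by
      refine fderiv_congr_of_eqOn hΩ0 (fun w hw => ?_) hw
      simp only [hh, Function.comp, hΦ, heq w hw.1 hw.2]
    have h2 : DifferentiableAt ℝ h (Φ w) := hhs.diffAt hL'.isOpen (hmaps w hw.1 hw.2)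
    have h3 : DifferentiableAt ℝ Φ w :=
      (hasFDerivAt_tangentLift (hτ.contDiffAt (hV.mem_nhds hw.2))).differentiableAt
    rw [h1, fderiv_comp w h2 h3]
    rfl
  have hg0 : ∀ j, eulerLagrangeForm (fun k _ => g k) (fun w => L w ^ 2) j z = 0 := by
    intro j
    have hY : Set.EqOn (dY j fun w => L w ^ 2)
        (fun w => fderiv ℝ h (Φ w) (0, fderiv ℝ τ w.1 (EuclideanSpace.single j 1)))
        (Ω ∩ Prod.fst ⁻¹' V) := by
      intro w hw
      change fderiv ℝ (fun w => L w ^ 2) w (0, EuclideanSpace.single j 1) = _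
      rw [hfeq w hw, fderiv_tangentLift_apply (hτ.contDiffAt (hV.mem_nhds hw.2))]
      simp
    have hΦd : HasFDerivAt Φ (fderiv ℝ Φ z) z :=
      (hasFDerivAt_tangentLift hτz).differentiableAt.hasFDerivAt
    have hτd : HasFDerivAt (fderiv ℝ τ) D2 z.1 :=
      ((hτz.fderiv_right (m := ∞) (by simp)).differentiableAt (by simp)).hasFDerivAt
    have hd : HasFDerivAt
        (fun w : Vec n × Vec n =>
          ((0 : Vec n), fderiv ℝ τ w.1 (EuclideanSpace.single j (1 : ℝ)))) _ z :=
      (hasFDerivAt_const (0 : Vec n) z).prodMk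
        ((hτd.comp z hasFDerivAt_fst).clm_apply
          (hasFDerivAt_const (EuclideanSpace.single j (1 : ℝ)) z))
    have hd2 := (hfd.hasFDerivAt.comp z hΦd).clm_apply hd
    have hvec : sprayVec (fun k _ => g k) z = (z.2, (-2 : ℝ) • g) := rfl
    have h1 := congrArg (fun A : Vec n →L[ℝ] ℝ => A (D (EuclideanSpace.single j 1))) hEL
    rw [eulerLagrangeForm, sprayD_congr hΩ0 hY hz0, sprayD_eq_fderiv, hvec, dX, hfeq z hz0,
      fderiv_tangentLift_apply hτz]
    have h2 : fderiv ℝ (fun w => fderiv ℝ h (Φ w)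
          (0, fderiv ℝ τ w.1 (EuclideanSpace.single j 1))) z (z.2, (-2 : ℝ) • g)
        = fderiv ℝ h (Φ z) (0, D2 z.2 (EuclideanSpace.single j 1))
          + fderiv ℝ (fderiv ℝ h) (Φ z) (fderiv ℝ Φ z (z.2, (-2 : ℝ) • g))
            (0, D (EuclideanSpace.single j 1)) := by
      refine (congrArg (fun A : Vec n × Vec n →L[ℝ] ℝ => A (z.2, (-2 : ℝ) • g)) hd2.fderiv).trans ?_
      simp [hD]
    -- By symmetry of `D²τ`, the second order term of `∂L²/∂xʲ` is the one produced by
    -- differentiating `Dτ(eⱼ)` along the spray, and the two cancel.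
    have h3 : (D (EuclideanSpace.single j 1),
        D 0 + D2 (EuclideanSpace.single j 1) z.2)
        = ((D (EuclideanSpace.single j 1), 0) : Vec n × Vec n)
          + (0, D2 z.2 (EuclideanSpace.single j 1)) := by
      rw [hsym]
      simp
    rw [h2, h3, map_add, hV']
    have h4 : fderiv ℝ (fderiv ℝ h) (Φ z) (sprayVec (geodesicCoeff L') (Φ z))
        (0, D (EuclideanSpace.single j 1)) = fderiv ℝ h (Φ z) (D (EuclideanSpace.single j 1), 0) :=
      h1
    rw [h4]
    ring
  have hfin : sprayVec (geodesicCoeff L) z = (z.2, (-2 : ℝ) • g) := by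
    refine Prod.ext rfl (congrArg (fun v : Vec n => (-2 : ℝ) • v) (PiLp.ext fun i => ?_))
    exact (eq_geodesicCoeff L z (hL.posDef z hz) (fun k _ => g k) hg0 i).symm
  rw [hfin, hV']

end SprayChange

/-! ### The geodesic spray on the tangent bundle, and its geodesics -/

section GeodesicSpray

variable {n : ℕ} {M : Type*} [TopologicalSpace M] [ChartedSpace (Vec n) M]
  {e e' : OpenPartialHomeomorph M (Vec n)}
  {F F' : TangentBundle (𝓡 n) M → ℝ}

theorem hasFDerivAt_coordChange (he : e ∈ IsManifold.maximalAtlas (𝓡 n) ∞ M)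
    (he' : e' ∈ IsManifold.maximalAtlas (𝓡 n) ∞ M) {z : Vec n × Vec n}
    (hz : z ∈ coordDomain e) (hz' : e.symm z.1 ∈ e'.source) :
    HasFDerivAt (coordChange e e') (fderiv ℝ (coordChange e e') z) z :=
  (hasFDerivAt_tangentLift ((contDiffOn_transition he he').contDiffAt
    ((isOpen_overlap e e').mem_nhds ⟨hz.1, hz'⟩))).differentiableAt.hasFDerivAt

variable [IsManifold (𝓡 n) ∞ M]

theorem fderiv_coordChange_sprayVec (hF : IsFinslerMetric F)
    (he : e ∈ IsManifold.maximalAtlas (𝓡 n) ∞ M)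
    (he' : e' ∈ IsManifold.maximalAtlas (𝓡 n) ∞ M) {z : Vec n × Vec n}
    (hz : z ∈ coordDomain e) (hz' : e.symm z.1 ∈ e'.source) :
    fderiv ℝ (coordChange e e') z (sprayVec (spray F e) z)
      = sprayVec (spray F e') (coordChange e e' z) :=
  fderiv_tangentLift_sprayVec (isOpen_overlap e e') (contDiffOn_transition he he')
    (hF.isLocalFinsler he) (hF.isLocalFinsler he') hz ⟨hz.1, hz'⟩
    (fderiv_transition_surjective he he' hz.1 hz')
    (fun _ hw hwV => coordChange_mem he he' hw hwV.2)
    (fun _ hw hwV => (inCoords_coordChange he he' hw.1 hwV.2 F).symm)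

/-- The derivative of a function along the geodesic spray does not depend on the chart. -/
theorem sprayD_coordChange (hF : IsFinslerMetric F)
    (he : e ∈ IsManifold.maximalAtlas (𝓡 n) ∞ M)
    (he' : e' ∈ IsManifold.maximalAtlas (𝓡 n) ∞ M) {f : TangentBundle (𝓡 n) M → ℝ}
    (hf : ContMDiffOn (𝓡 n).tangent 𝓘(ℝ, ℝ) ∞ f (slitTangent (n := n) M)) {z : Vec n × Vec n}
    (hz : z ∈ coordDomain e) (hz' : e.symm z.1 ∈ e'.source) :
    sprayD (spray F e') (inCoords e' f) (coordChange e e' z)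
      = sprayD (spray F e) (inCoords e f) z := by
  have hΩ : IsOpen (coordDomain e ∩ Prod.fst ⁻¹' (e.target ∩ e.symm ⁻¹' e'.source)) :=
    (isOpen_coordDomain e).inter ((isOpen_overlap e e').preimage continuous_fst)
  have h1 : fderiv ℝ (inCoords e f) z = fderiv ℝ (inCoords e' f ∘ coordChange e e') z :=
    fderiv_congr_of_eqOn hΩ (fun w hw => (inCoords_coordChange he he' hw.1.1 hw.2.2 f).symm)
      ⟨hz, hz.1, hz'⟩
  have h2 := (contDiffOn_inCoords he' hf).diffAt (isOpen_coordDomain e')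
    (coordChange_mem he he' hz hz')
  rw [sprayD_eq_fderiv, sprayD_eq_fderiv, h1,
    fderiv_comp z h2 (hasFDerivAt_coordChange he he' hz hz').differentiableAt,
    ContinuousLinearMap.comp_apply, fderiv_coordChange_sprayVec hF he he' hz hz']

theorem chartAt_mem_maximalAtlas (p : M) :
    chartAt (Vec n) p ∈ IsManifold.maximalAtlas (𝓡 n) ∞ M :=
  IsManifold.chart_mem_maximalAtlas p

/-- The function on `T₀M` given by compatible functions of the induced coordinates. -/
def glue (h : OpenPartialHomeomorph M (Vec n) → Vec n × Vec n → ℝ)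
    (v : TangentBundle (𝓡 n) M) : ℝ :=
  h (chartAt (Vec n) v.1) (coordInv (chartAt (Vec n) v.1) v)

/-- Compatibility of functions of the induced coordinates under changes of charts. -/
def IsCompatible (h : OpenPartialHomeomorph M (Vec n) → Vec n × Vec n → ℝ) : Prop :=
  ∀ e ∈ IsManifold.maximalAtlas (𝓡 n) ∞ M, ∀ e' ∈ IsManifold.maximalAtlas (𝓡 n) ∞ M,
    ∀ z ∈ coordDomain e, e.symm z.1 ∈ e'.source → h e' (coordChange e e' z) = h e z

theorem inCoords_glue {h : OpenPartialHomeomorph M (Vec n) → Vec n × Vec n → ℝ}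
    (hh : IsCompatible h) (he : e ∈ IsManifold.maximalAtlas (𝓡 n) ∞ M) {z : Vec n × Vec n}
    (hz : z ∈ coordDomain e) : inCoords e (glue h) z = h e z := by
  have hc := chartAt_mem_maximalAtlas (n := n) (e.symm z.1)
  have hs := mem_chart_source (Vec n) (e.symm z.1)
  rw [← hh e he _ hc z hz hs, ← coordInv_coordMap_eq he hc hz.1 hs]
  rfl

theorem contMDiffOn_glue {h : OpenPartialHomeomorph M (Vec n) → Vec n × Vec n → ℝ}
    (hh : IsCompatible h)
    (hs : ∀ e ∈ IsManifold.maximalAtlas (𝓡 n) ∞ M, ContDiffOn ℝ ∞ (h e) (coordDomain e)) :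
    ContMDiffOn (𝓡 n).tangent 𝓘(ℝ, ℝ) ∞ (glue h) (slitTangent (n := n) M) := by
  intro v hv
  set e := chartAt (Vec n) v.1 with he0
  have he : e ∈ IsManifold.maximalAtlas (𝓡 n) ∞ M := chartAt_mem_maximalAtlas v.1
  have hO : IsOpen (Bundle.TotalSpace.proj ⁻¹' e.source : Set (TangentBundle (𝓡 n) M)) :=
    e.open_source.preimage (FiberBundle.continuous_proj (Vec n) (TangentSpace (𝓡 n)))
  have hvs : v ∈ (Bundle.TotalSpace.proj ⁻¹' e.source : Set (TangentBundle (𝓡 n) M)) :=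
    mem_chart_source (Vec n) v.1
  have h1 : ContMDiffOn (𝓡 n).tangent 𝓘(ℝ, ℝ) ∞ (fun w => h e (coordInv e w))
      (slitTangent (n := n) M ∩ Bundle.TotalSpace.proj ⁻¹' e.source) :=
    (hs e he).contMDiffOn.comp ((contMDiffOn_coordInv he).mono Set.inter_subset_right)
      fun w hw => coordInv_mem_coordDomain he hw.1 hw.2
  have h2 : ContMDiffOn (𝓡 n).tangent 𝓘(ℝ, ℝ) ∞ (glue h)
      (slitTangent (n := n) M ∩ Bundle.TotalSpace.proj ⁻¹' e.source) := by
    refine h1.congr fun w hw => ?_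
    rw [← inCoords_glue hh he (coordInv_mem_coordDomain he hw.1 hw.2), inCoords_eq,
      coordMap_coordInv he hw.2]
  exact (contMDiffWithinAt_inter (hO.mem_nhds hvs)).1 (h2 v ⟨hv, hvs⟩)

theorem posHomogeneous_glue {h : OpenPartialHomeomorph M (Vec n) → Vec n × Vec n → ℝ}
    (hs : ∀ e ∈ IsManifold.maximalAtlas (𝓡 n) ∞ M, HomogOn 1 (h e) (coordDomain e)) :
    PosHomogeneous (glue h) := by
  intro p v r hv hr
  have he := chartAt_mem_maximalAtlas (n := n) p
  have h1 := hs _ he _ (coordInv_mem_coordDomain he (v := ⟨p, v⟩) hv (mem_chart_source _ p)) r hr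
  rw [pow_one] at h1
  refine Eq.trans ?_ h1
  exact congrArg (fun u : Vec n => h (chartAt (Vec n) p) (chartAt (Vec n) p p, u))
    (map_smul (mfderiv (𝓡 n) (𝓡 n) (chartAt (Vec n) p) p) r v)

theorem contDiffOn_sprayVec (hF : IsFinslerMetric F)
    (he : e ∈ IsManifold.maximalAtlas (𝓡 n) ∞ M) :
    ContDiffOn ℝ ∞ (sprayVec (spray F e)) (coordDomain e) := by
  refine contDiffOn_snd.prodMk (ContDiffOn.const_smul _ ?_)
  exact contDiffOn_piLp' 2 fun k => (hF.isLocalFinsler he).smooth_geodesicCoeff k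

/-- Integral curves of the geodesic spray exist and are smooth. -/
theorem exists_integralCurve (hF : IsFinslerMetric F)
    (he : e ∈ IsManifold.maximalAtlas (𝓡 n) ∞ M) {z : Vec n × Vec n} (hz : z ∈ coordDomain e) :
    ∃ (α : ℝ → Vec n × Vec n) (δ : ℝ), 0 < δ ∧ α 0 = z ∧ (∀ t ∈ Set.Ioo (-δ) δ,
      α t ∈ coordDomain e ∧ HasDerivAt α (sprayVec (spray F e) (α t)) t) ∧
      ContDiffOn ℝ ∞ α (Set.Ioo (-δ) δ) := by
  have hV := contDiffOn_sprayVec hF he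
  have hO := isOpen_coordDomain e
  obtain ⟨α, hα0, ε, hε, hα⟩ := ((hV.contDiffAt (hO.mem_nhds hz)).of_le
    (by simp : (1 : WithTop ℕ∞) ≤ ∞)).exists_forall_mem_closedBall_exists_eq_forall_mem_Ioo_hasDerivAt₀ 0
  simp only [zero_sub, zero_add] at hα
  have hc : ContinuousAt α 0 := (hα 0 ⟨by linarith, hε⟩).continuousAt
  obtain ⟨η, hη, hsub⟩ := Metric.mem_nhds_iff.1 (hc (hO.mem_nhds (hα0 ▸ hz)))
  -- The curve must stay in the coordinate domain on a closed interval, on which regularity of the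
  -- flow equation gives smoothness.
  set δ := min (ε / 2) (η / 2) with hδ
  have hδ0 : 0 < δ := by positivity
  have hδε : δ < ε := lt_of_le_of_lt (min_le_left _ _) (by linarith)
  have hδη : δ < η := lt_of_le_of_lt (min_le_right _ _) (by linarith)
  have hI : ∀ t ∈ Set.Icc (-δ) δ,
      α t ∈ coordDomain e ∧ HasDerivAt α (sprayVec (spray F e) (α t)) t := by
    intro t ht
    refine ⟨hsub ?_, hα t ⟨by linarith [ht.1], by linarith [ht.2]⟩⟩
    rw [Metric.mem_ball, Real.dist_eq, sub_zero, abs_lt]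
    exact ⟨by linarith [ht.1], by linarith [ht.2]⟩
  refine ⟨α, δ, hδ0, hα0, fun t ht => hI t (Set.Ioo_subset_Icc_self ht), ?_⟩
  refine ContDiffOn.mono (ODE.contDiffOn_enat_Icc_of_hasDerivWithinAt (n := ⊤)
    (f := fun _ => sprayVec (spray F e)) (u := coordDomain e) ?_
    (fun t ht => (hI t ht).2.hasDerivWithinAt) fun t ht => (hI t ht).1) Set.Ioo_subset_Icc_self
  exact hV.comp contDiffOn_snd fun p hp => hp.2

theorem deriv_fst_of_hasDerivAt_sprayVec {G : Fin n → Vec n × Vec n → ℝ}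
    {β : ℝ → Vec n × Vec n} {t : ℝ} (h : HasDerivAt β (sprayVec G (β t)) t) :
    HasDerivAt (fun s => (β s).1) (β t).2 t :=
  (hasFDerivAt_fst (𝕜 := ℝ) (p := β t)).comp_hasDerivAt t h

theorem hasDerivAt_snd_comp {β : ℝ → Vec n × Vec n} {v : Vec n × Vec n} {t : ℝ}
    (h : HasDerivAt β v t) : HasDerivAt (fun s => (β s).2) v.2 t :=
  (hasFDerivAt_snd (𝕜 := ℝ) (p := β t)).comp_hasDerivAt t h

/-- Integral curves of the geodesic spray project to geodesics. -/
theorem isGeodesicOn_of_integralCurve (hF : IsFinslerMetric F)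
    (he : e ∈ IsManifold.maximalAtlas (𝓡 n) ∞ M) {α : ℝ → Vec n × Vec n} {I : Set ℝ}
    (hI : IsOpen I) (hI' : I.OrdConnected) (hα : ContDiffOn ℝ ∞ α I)
    (hd : ∀ t ∈ I, α t ∈ coordDomain e ∧ HasDerivAt α (sprayVec (spray F e) (α t)) t) :
    IsGeodesicOn F (fun t => e.symm (α t).1) I := by
  -- The geodesic equation is required in every chart; invariance of the spray carries the integral
  -- curve to an integral curve in the coordinates of `e'`.
  have key : ∀ e' ∈ IsManifold.maximalAtlas (𝓡 n) ∞ M, ∀ t ∈ I, e.symm (α t).1 ∈ e'.source →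
      HasDerivAt (fun s => coordChange e e' (α s))
        (sprayVec (spray F e') (coordChange e e' (α t))) t := by
    intro e' he' t ht hs
    rw [← fderiv_coordChange_sprayVec hF he he' (hd t ht).1 hs]
    exact (hasFDerivAt_coordChange he he' (hd t ht).1 hs).comp_hasDerivAt t (hd t ht).2
  have key1 : ∀ e' ∈ IsManifold.maximalAtlas (𝓡 n) ∞ M, ∀ t ∈ I, e.symm (α t).1 ∈ e'.source →
      HasDerivAt (e' ∘ fun s => e.symm (α s).1) (coordChange e e' (α t)).2 t :=
    fun e' he' t ht hs => deriv_fst_of_hasDerivAt_sprayVec (key e' he' t ht hs)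
  have hcont : ContinuousOn (fun t => e.symm (α t).1) I :=
    e.continuousOn_symm.comp (continuous_fst.comp_continuousOn hα.continuousOn)
      fun t ht => (hd t ht).1.1
  refine ⟨hI, hI', ?_, ?_, ?_⟩
  · exact (contMDiffOn_symm_of_mem_maximalAtlas he).comp
      (contDiff_fst.comp_contDiffOn hα).contMDiffOn fun t ht => (hd t ht).1.1
  · intro e' he' t ht hs
    rw [(key1 e' he' t ht hs).deriv]
    exact (coordChange_mem he he' (hd t ht).1 hs).2
  · intro e' he' t ht hs i
    have hN : ∀ᶠ s in nhds t, s ∈ I ∧ e.symm (α s).1 ∈ e'.source :=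
      (hI.eventually_mem ht).and
        ((hcont.continuousAt (hI.mem_nhds ht)).eventually (e'.open_source.mem_nhds hs))
    have h1 : deriv (e' ∘ fun s => e.symm (α s).1) =ᶠ[nhds t]
        fun s => (coordChange e e' (α s)).2 := by
      filter_upwards [hN] with s hs
      exact (key1 e' he' s hs.1 hs.2).deriv
    have h2 : HasDerivAt (fun s => (coordChange e e' (α s)).2)
        (sprayVec (spray F e') (coordChange e e' (α t))).2 t :=
      hasDerivAt_snd_comp (key e' he' t ht hs)
    rw [h1.deriv_eq, h2.deriv, h1.eq_of_nhds]
    change (-2 : ℝ) * spray F e' i (coordChange e e' (α t))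
      + 2 * spray F e' i (coordChange e e' (α t)) = 0
    ring

/-- If the geodesics of `F` are geodesics of `F'` up to reparametrization, then the spray
coefficients differ by a multiple of `y`. -/
theorem exists_spray_eq_add_smul (hF : IsFinslerMetric F) (hF' : IsFinslerMetric F')
    (hrel : GeodesicsAreGeodesicsOf F F') (he : e ∈ IsManifold.maximalAtlas (𝓡 n) ∞ M)
    {z : Vec n × Vec n} (hz : z ∈ coordDomain e) :
    ∃ c : ℝ, ∀ i, spray F' e i z = spray F e i z + c * z.2 i := by
  obtain ⟨α, δ, hδ, hα0, hd, hα⟩ := exists_integralCurve hF he hz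
  obtain ⟨J, φ, hφ, hφ', hbij, hgeo⟩ := hrel _ _
    (isGeodesicOn_of_integralCurve hF he isOpen_Ioo Set.ordConnected_Ioo hα hd)
  obtain ⟨s, hsJ, hs0⟩ := hbij.surjOn (show (0 : ℝ) ∈ Set.Ioo (-δ) δ from ⟨by linarith, hδ⟩)
  have hJ := hgeo.isOpen
  have hφd : ∀ t ∈ J, HasDerivAt φ (deriv φ t) t := fun t ht =>
    ((hφ.contDiffAt (hJ.mem_nhds ht)).differentiableAt (by simp)).hasDerivAt
  have hφdd : HasDerivAt (deriv φ) (deriv (deriv φ) s) s :=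
    (((hφ.deriv_of_isOpen hJ (m := ∞) (by simp)).contDiffAt (hJ.mem_nhds hsJ)).differentiableAt
      (by simp)).hasDerivAt
  have hx : ∀ t ∈ J, HasDerivAt (fun t => (α (φ t)).1) (deriv φ t • (α (φ t)).2) t := by
    intro t ht
    exact (deriv_fst_of_hasDerivAt_sprayVec (hd _ (hbij.mapsTo ht)).2).scomp t (hφd t ht)
  have hc : ∀ t ∈ J, (e ∘ ((fun t => e.symm (α t).1) ∘ φ)) t = (α (φ t)).1 :=
    fun t ht => e.right_inv (hd _ (hbij.mapsTo ht)).1.1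
  have h1 : ∀ t ∈ J, deriv (e ∘ ((fun t => e.symm (α t).1) ∘ φ)) t
      = deriv φ t • (α (φ t)).2 := by
    intro t ht
    rw [Filter.EventuallyEq.deriv_eq (Set.EqOn.eventuallyEq_of_mem hc (hJ.mem_nhds ht)),
      (hx t ht).deriv]
  have hy : HasDerivAt (fun t => (α (φ t)).2)
      (deriv φ s • (sprayVec (spray F e) (α (φ s))).2) s := by
    have h2 : HasDerivAt (fun t => (α t).2) (sprayVec (spray F e) (α (φ s))).2 (φ s) :=
      hasDerivAt_snd_comp (hd _ (hbij.mapsTo hsJ)).2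
    exact h2.scomp s (hφd s hsJ)
  have h2 : deriv (deriv (e ∘ ((fun t => e.symm (α t).1) ∘ φ))) s
      = deriv φ s • deriv φ s • (sprayVec (spray F e) (α (φ s))).2
        + deriv (deriv φ) s • (α (φ s)).2 := by
    rw [Filter.EventuallyEq.deriv_eq (Set.EqOn.eventuallyEq_of_mem h1 (hJ.mem_nhds hsJ)),
      (hφdd.fun_smul hy).deriv]
  have hsrc : ((fun t => e.symm (α t).1) ∘ φ) s ∈ e.source :=
    e.map_target (hd _ (hbij.mapsTo hsJ)).1.1
  have hp := hφ' s hsJ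
  -- At the parameter `s` with `φ s = 0` the velocity is `φ' y` and the acceleration `-2 φ'² G + φ''
  -- y`. The equation for `F'` with 2-homogeneous `G'` gives `2 φ'² (G' - G) = -φ'' y`.
  refine ⟨- deriv (deriv φ) s / (2 * deriv φ s ^ 2), fun i => ?_⟩
  have h3 := hgeo.equation e he s hsJ hsrc i
  have hcs : e (((fun t => e.symm (α t).1) ∘ φ) s) = (α (φ s)).1 := hc s hsJ
  rw [h2, hcs, h1 s hsJ, hs0, hα0] at h3
  have h4 : spray F' e i (z.1, deriv φ s • z.2) = deriv φ s ^ 2 * spray F' e i z :=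
    (hF'.isLocalFinsler he).homog_geodesicCoeff i z hz _ hp
  rw [h4] at h3
  have h5 : deriv φ s * (deriv φ s * (-2 * spray F e i z)) + deriv (deriv φ) s * z.2 i
      + 2 * (deriv φ s ^ 2 * spray F' e i z) = 0 := h3
  field_simp
  linear_combination h5

end GeodesicSpray

/-! ### The projective factor and constant flag curvature -/

section ProjectivelyRelated

variable {n : ℕ} {M : Type*} [TopologicalSpace M] [ChartedSpace (Vec n) M]
  {e : OpenPartialHomeomorph M (Vec n)}
  {F F' P : TangentBundle (𝓡 n) M → ℝ}

theorem hasConstantFlagCurvature_iff : HasConstantFlagCurvature F ↔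
    ∃ κ : ℝ, ∀ e ∈ IsManifold.maximalAtlas (𝓡 n) ∞ M,
      HasFlagCurvatureOn κ (inCoords e F) (coordDomain e) :=
  exists_congr fun _ => ⟨fun h e he z hz => h e he z hz.1 hz.2,
    fun h e he z hz hz' => h e he z ⟨hz, hz'⟩⟩

theorem hamelEquation_iff : HamelEquation F P ↔
    ∀ e ∈ IsManifold.maximalAtlas (𝓡 n) ∞ M, ∀ z ∈ coordDomain e, ∀ i,
      eulerLagrangeForm (spray F e) (inCoords e P) i z = 0 :=
  ⟨fun h e he z hz => h e he z hz.1 hz.2, fun h e he z hz hz' => h e he z ⟨hz, hz'⟩⟩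

variable [IsManifold (𝓡 n) ∞ M]

theorem IsProjectiveFactor.isLocalFactor (hP : IsProjectiveFactor F F' P)
    (hF : IsFinslerMetric F) (he : e ∈ IsManifold.maximalAtlas (𝓡 n) ∞ M) :
    IsLocalFactor (spray F e) (spray F' e) (inCoords e P) (coordDomain e) where
  isOpen := isOpen_coordDomain e
  conic := isConic_prod_compl_zero _
  smooth_spray := (hF.isLocalFinsler he).smooth_geodesicCoeff
  homog_spray := (hF.isLocalFinsler he).homog_geodesicCoeff
  smooth := contDiffOn_inCoords he hP.smooth
  homog := homogOn_inCoords he hP.homogeneous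
  spray_eq z hz k := hP.spray_eq e he z hz.1 hz.2 k

theorem exists_isProjectiveFactor (hF : IsFinslerMetric F) (hF' : IsFinslerMetric F')
    (hrel : GeodesicsAreGeodesicsOf F F') :
    ∃ P : TangentBundle (𝓡 n) M → ℝ, IsProjectiveFactor F F' P := by
  -- Pointwise factors carry no smoothness; the formula `S(F') / (2 F')` does, and `S'(F') = 0`
  -- identifies it with the pointwise factor.
  set h : OpenPartialHomeomorph M (Vec n) → Vec n × Vec n → ℝ := fun e z =>
    sprayD (spray F e) (inCoords e F') z / (2 * inCoords e F' z) with hh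
  have hcomp : IsCompatible h := by
    intro e he e' he' z hz hz'
    simp only [hh, sprayD_coordChange hF he he' hF'.smooth hz hz',
      inCoords_coordChange he he' hz.1 hz']
  refine ⟨glue h, contMDiffOn_glue hcomp fun e he => ?_, posHomogeneous_glue fun e he => ?_,
    fun e he z hz hz' i => ?_⟩
  · have hL := hF.isLocalFinsler he
    have hL' := hF'.isLocalFinsler he
    exact (contDiffOn_sprayD hL.isOpen hL.smooth_geodesicCoeff hL'.smooth).div
      (contDiffOn_const.mul hL'.smooth) fun z hz => (mul_pos two_pos (hL'.pos z hz)).ne'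
  · intro z hz r hr
    have hL := hF.isLocalFinsler he
    have hL' := hF'.isLocalFinsler he
    have h1 := hL'.homog.along_spray hL.isOpen hL.conic hL.homog_geodesicCoeff hL'.smooth z hz r hr
    have h2 := hL'.homog z hz r hr
    have h3 := (hL'.pos z hz).ne'
    simp only [hh, spray, h1, h2]
    field_simp
    ring
  · have hzd : z ∈ coordDomain e := ⟨hz, hz'⟩
    have hL' := hF'.isLocalFinsler he
    obtain ⟨c, hc⟩ := exists_spray_eq_add_smul hF hF' hrel he hzd
    have h1 := sprayD_of_eq_add_smul hc (inCoords e F')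
    have h2 : sprayD (spray F' e) (inCoords e F') z = 0 := hL'.sprayD_self hzd
    have h3 := (hL'.pos z hzd).ne'
    rw [h2, hL'.homog.euler hL'.isOpen hL'.smooth hzd] at h1
    have h4 : h e z = c := by
      simp only [hh]
      field_simp
      push_cast at h1
      linarith
    rw [inCoords_glue hcomp he hzd, h4, hc]

theorem hamelEquation_iff_dhDjVanishes (hF : IsFinslerMetric F)
    (hP : IsProjectiveFactor F F' P) : HamelEquation F P ↔ DhDjVanishes F P := by
  have h := fun e (he : e ∈ IsManifold.maximalAtlas (𝓡 n) ∞ M) =>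
    eulerLagrangeForm_eq_zero_iff_dhdJ (isOpen_coordDomain e) (isConic_prod_compl_zero _)
      (hF.isLocalFinsler he).smooth_geodesicCoeff (hF.isLocalFinsler he).homog_geodesicCoeff
      (contDiffOn_inCoords he hP.smooth) (homogOn_inCoords he hP.homogeneous)
  rw [hamelEquation_iff]
  exact ⟨fun hE e he z hz hz' => (h e he).1 (hE e he) z ⟨hz, hz'⟩,
    fun hD e he => (h e he).2 fun z hz => hD e he z hz.1 hz.2⟩

/-- If both metrics have constant flag curvature, then the projective factor is a Hamel
function. -/
theorem hamelEquation_of_constantFlagCurvature (hn : 2 ≤ n) (hF : IsFinslerMetric F)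
    (hF' : IsFinslerMetric F') (hP : IsProjectiveFactor F F' P)
    (h : HasConstantFlagCurvature F) (h' : HasConstantFlagCurvature F') : HamelEquation F P := by
  obtain ⟨κ, hκ⟩ := hasConstantFlagCurvature_iff.1 h
  obtain ⟨κ', hκ'⟩ := hasConstantFlagCurvature_iff.1 h'
  exact hamelEquation_iff.2 fun e he z hz i =>
    eulerLagrangeForm_eq_zero_of_flagCurvature hn (fun _ hw => hw.2) (hF.isLocalFinsler he)
      (hF'.isLocalFinsler he) (hP.isLocalFactor hF he) (hκ e he) (hκ' e he) hz i

/-- A Hamel projective factor preserves constant flag curvature. -/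
theorem constantFlagCurvature_of_hamelEquation [ConnectedSpace M] (hn : 2 ≤ n)
    (hF : IsFinslerMetric F) (hF' : IsFinslerMetric F') (hP : IsProjectiveFactor F F' P)
    (h : HasConstantFlagCurvature F) (hE : HamelEquation F P) : HasConstantFlagCurvature F' := by
  obtain ⟨κ, hκ⟩ := hasConstantFlagCurvature_iff.1 h
  rw [hamelEquation_iff] at hE
  set K : OpenPartialHomeomorph M (Vec n) → Vec n × Vec n → ℝ := fun e =>
    curvatureRatio κ (inCoords e F) (inCoords e F') (inCoords e P) with hK
  -- The ratio involves only `F`, `F'`, `P` and `S(P)`, all independent of the chart.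
  have hcomp : IsCompatible K := by
    intro e he e' he' z hz hz'
    have h1 := sprayD_coordChange hF he he' hP.smooth hz hz'
    simp only [spray] at h1
    simp only [hK, curvatureRatio, ricciFactor, h1, inCoords_coordChange he he' hz.1 hz']
  -- Letting both vectors vary records independence of the fibre coordinate (at `q = p`) together
  -- with local constancy along `M`.
  have hloc : ∀ p : M, ∀ᶠ q in nhds p, ∀ v w : Vec n, v ≠ 0 → w ≠ 0 →
      glue K ⟨q, v⟩ = glue K ⟨p, w⟩ := by
    intro p
    set e := chartAt (Vec n) p with he0
    have he : e ∈ IsManifold.maximalAtlas (𝓡 n) ∞ M := chartAt_mem_maximalAtlas p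
    have hp : p ∈ e.source := mem_chart_source _ p
    obtain ⟨r, hr, hsub⟩ := Metric.isOpen_iff.1 e.open_target (e p) (e.map_source hp)
    have hval : ∀ q ∈ e.source, ∀ v : Vec n, v ≠ 0 →
        (coordInv e ⟨q, v⟩).2 ≠ 0 ∧ glue K ⟨q, v⟩ = K e (coordInv e ⟨q, v⟩) := by
      intro q hq v hv
      have hmem := coordInv_mem_coordDomain he (v := ⟨q, v⟩) hv hq
      refine ⟨hmem.2, ?_⟩
      rw [← inCoords_glue hcomp he hmem, inCoords_eq, coordMap_coordInv he hq]
    filter_upwards [e.open_source.mem_nhds hp,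
      (e.continuousAt hp).eventually (Metric.ball_mem_nhds (e p) hr)] with q hq hqr v w hv hw
    rw [(hval q hq v hv).2, (hval p hp w hw).2]
    exact curvatureRatio_eq_of_mem_ball hn e.open_target (hF.isLocalFinsler he)
      (hF'.isLocalFinsler he) (hP.isLocalFactor hF he) (hκ e he) (hE e he) hsub
      ⟨hqr, (hval q hq v hv).1⟩ ⟨Metric.mem_ball_self hr, (hval p hp w hw).1⟩
  have : Nontrivial (Vec n) := by
    have : Nonempty (Fin n) := ⟨⟨0, by omega⟩⟩
    infer_instance
  obtain ⟨v₀, hv₀⟩ := exists_ne (0 : Vec n)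
  have hlc : IsLocallyConstant fun p : M => glue K ⟨p, v₀⟩ :=
    (IsLocallyConstant.iff_eventually_eq _).2 fun p =>
      (hloc p).mono fun q hq => hq v₀ v₀ hv₀ hv₀
  obtain ⟨p₀⟩ := (inferInstance : Nonempty M)
  refine hasConstantFlagCurvature_iff.2 ⟨glue K ⟨p₀, v₀⟩, fun e he z hz i j => ?_⟩
  have h1 : glue K ⟨p₀, v₀⟩ = K e z := by
    rw [hlc.apply_eq_of_preconnectedSpace p₀ (e.symm z.1), ← inCoords_glue hcomp he hz]
    exact (hloc (e.symm z.1)).self_of_nhds _ _ hv₀ (coordMap_mem_slit he hz)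
  rw [h1]
  exact jacobi_eq_curvatureRatio (hF.isLocalFinsler he) (hF'.isLocalFinsler he)
    (hP.isLocalFactor hF he) (hκ e he) (hE e he) hz i j

theorem IsProjectiveFactor.neg (hP : IsProjectiveFactor F F' P) :
    IsProjectiveFactor F' F fun v => -P v where
  smooth := hP.smooth.neg
  homogeneous p v r hv hr := by
    change -P ⟨p, r • v⟩ = r * -P ⟨p, v⟩
    rw [hP.homogeneous p v r hv hr, mul_neg]
  spray_eq e he z hz hz' i := by
    rw [hP.spray_eq e he z hz hz' i]
    simp only [inCoords]
    ring

theorem hamelEquation_neg_iff (hF : IsFinslerMetric F) (hP : IsProjectiveFactor F F' P) :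
    HamelEquation F' (fun v => -P v) ↔ HamelEquation F P := by
  rw [hamelEquation_iff, hamelEquation_iff]
  refine forall₅_congr fun e he z hz i => ?_
  have hl := hP.isLocalFactor hF he
  have h1 : inCoords e (fun v => -P v) = fun w => (-1) * inCoords e P w := by
    funext w
    simp [inCoords]
  rw [h1, eulerLagrangeForm_const_mul hl.isOpen hl.smooth _ hz, hl.eulerLagrangeForm_eq hz]
  simp

end ProjectivelyRelated

end FinslerGeometry

end

/-! ### The main theorem -/

theorem theorem5p2 {n : ℕ} (hn : 3 ≤ n) {M : Type*} [TopologicalSpace M]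
    [ChartedSpace (Vec n) M] [IsManifold (𝓡 n) ∞ M] [ConnectedSpace M]
    (F F' : TangentBundle (𝓡 n) M → ℝ)
    (hF : IsFinslerMetric F) (hF' : IsFinslerMetric F')
    (hrel : ProjectivelyRelated F F') :
    (∃ P : TangentBundle (𝓡 n) M → ℝ, IsProjectiveFactor F F' P) ∧
    ∀ P : TangentBundle (𝓡 n) M → ℝ, IsProjectiveFactor F F' P →
      (HasConstantFlagCurvature F → (HasConstantFlagCurvature F' ↔ HamelEquation F P)) ∧
      (HasConstantFlagCurvature F' → (HasConstantFlagCurvature F ↔ HamelEquation F P)) ∧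
      (HamelEquation F P ↔ DhDjVanishes F P) := by
  have hn2 : 2 ≤ n := by omega
  refine ⟨exists_isProjectiveFactor hF hF' hrel.1,
    fun P hP => ⟨fun h => ⟨fun h' => ?_, fun hE => ?_⟩, fun h' => ⟨fun h => ?_, fun hE => ?_⟩,
      hamelEquation_iff_dhDjVanishes hF hP⟩⟩
  · exact hamelEquation_of_constantFlagCurvature hn2 hF hF' hP h h'
  · exact constantFlagCurvature_of_hamelEquation hn2 hF hF' hP h hE
  · exact hamelEquation_of_constantFlagCurvature hn2 hF hF' hP h h'
  -- The roles of the metrics are exchanged: the factor from `F'` to `F` is `-P`, and its Hamel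
  -- equation for `S'` is that of `P` for `S`.
  · exact constantFlagCurvature_of_hamelEquation hn2 hF' hF hP.neg h'
      ((hamelEquation_neg_iff hF hP).2 hE)
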